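/- Let $(\Omega,\mathcal F,\mathbb P)$ be a probability space and let $\mathcal H_1\subset L^2(\Omega)=L^2(\Omega,\mathcal F,\mathbb P;\mathbb R)$ be a Gaussian Hilbert space, i.e. a closed linear subspace consisting of centered (possibly degenerate) Gaussian random variables, such that $\mathcal F=\sigma(\mathcal H_1)$ is the $\sigma$-field generated by the random variables in $\mathcal H_1$ (a random variable being in $\mathcal H_1$ if its class modulo almost sure equality is). Let $\mathcal H$ be a real separable Hilbert space and $W:\mathcal H\to\mathcal H_1$ a unitary operator (linear, surjective, $\mathbb E[W(h)W(k)]=\langle h,k\rangle_{\mathcal H}$). For $n\ge 0$ let $\overline{\mathcal P}_n$ be the closure in $L^2(\Omega)$ of the space $\mathcal P_n$ of all $p(\xi_1,\dots,\xi_m)$ with $m\in\mathbb N$, $\xi_i\in\mathcal H_1$ and $p$ a real polynomial of degree $\le n$; let $\overline{\mathcal P}_{-1}=\{0\}$, let $\mathcal H_n=\overline{\mathcal P}_n\cap\overline{\mathcal P}_{n-1}^{\perp}$ (for $n=1$ this is the given space $\mathcal H_1$) be the $n$-th Wiener chaos, and let $J_n$ be the orthogonal projection of $L^2(\Omega)$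 onto it. Define $$\mathrm{Dom}(L)=\Big\{F\in L^2(\Omega):\ \sum_{n=0}^\infty n^2\,\mathbb E\big[|J_nF|^2\big]<\infty\Big\},\qquad LF=\sum_{n=0}^\infty -n\,J_nF .$$ Let the Malliavin derivative $D:\mathbb D^{1,2}\subset L^2(\Omega)\to L^2(\Omega;\mathcal H)$ be the closure of the (closable) operator defined on polynomial random variables by $$D\,p(W(h_1),\dots,W(h_m))=\sum_{i=1}^m\partial_ip(W(h_1),\dots,W(h_m))\,h_i ,$$ and let the divergence $\delta:\mathrm{Dom}(\delta)\subset L^2(\Omega;\mathcal H)\to L^2(\Omega)$ be its Hilbert space adjoint: $u\in\mathrm{Dom}(\delta)$ if and only if there is a constant $C$ with $|\mathbb E[\langle DG,u\rangle_{\mathcal H}]|\le C\|G\|_{L^2(\Omega)}$ for all $G\in\mathbb D^{1,2}$, and then $\mathbb E[G\,\delta(u)]=\mathbb E[\langle DG,u\rangle_{\mathcal H}]$ for all $G\in\mathbb D^{1,2}$. Then for every $F\in L^2(\Omega)$: $F\in\mathrm{Dom}(L)$ if and only if $F\in\mathbb D^{1,2}$ and $DF\in\mathrm{Dom}(\delta)$;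 and in this case $\delta(DF)=-LF$. -/

import Mathlib

open MeasureTheory ProbabilityTheory
open scoped NNReal ENNReal

noncomputable section

namespace Malliavin

section Chaos

variable {Ω : Type*} [MeasurableSpace Ω] {P : Measure Ω}

/-- A Gaussian Hilbert space: a closed linear subspace of `L²(Ω, P)` consisting of centered
(possibly degenerate) Gaussian random variables. -/
structure IsGaussianHilbertSpace (H₁ : Submodule ℝ (Lp ℝ 2 P)) : Prop where
  isClosed : IsClosed (H₁ : Set (Lp ℝ 2 P))
  gaussian : ∀ ξ ∈ H₁, ∃ v : ℝ≥0, P.map (ξ : Ω → ℝ) = gaussianReal 0 v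

/-- The `σ`-field `σ(H₁)` generated by the random variables in `H₁`. Elements of `H₁` are classes
modulo almost sure equality, and a random variable is in `H₁` when its class is. -/
abbrev sigmaField (H₁ : Submodule ℝ (Lp ℝ 2 P)) : MeasurableSpace Ω :=
  ⨆ X ∈ {X : Ω → ℝ | Measurable X ∧ ∃ ξ ∈ H₁, X =ᵐ[P] (ξ : Ω → ℝ)},
    MeasurableSpace.comap X (borel ℝ)

/-- The space `𝒫ₙ(H₁)` of the random variables `p(ξ₁, …, ξₘ)`, where `p` is a real polynomial of
degree at most `n` and `ξ₁, …, ξₘ ∈ H₁`. -/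
def polySpace (H₁ : Submodule ℝ (Lp ℝ 2 P)) (n : ℕ) : Submodule ℝ (Lp ℝ 2 P) where
  carrier := {F | ∃ (m : ℕ) (p : MvPolynomial (Fin m) ℝ) (ξ : Fin m → H₁), p.totalDegree ≤ n ∧
    (F : Ω → ℝ) =ᵐ[P] fun ω => MvPolynomial.eval (fun i => (ξ i : Lp ℝ 2 P) ω) p}
  zero_mem' := ⟨0, 0, 0, by simp, by
    filter_upwards [Lp.coeFn_zero ℝ 2 P] with ω h
    simpa using h⟩
  add_mem' := by
    rintro F G ⟨m, p, ξ, hp, hF⟩ ⟨k, q, η, hq, hG⟩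
    refine ⟨m + k, MvPolynomial.rename (Fin.castAdd k) p + MvPolynomial.rename (Fin.natAdd m) q,
      Fin.append ξ η, ?_, ?_⟩
    · refine (MvPolynomial.totalDegree_add _ _).trans (max_le ?_ ?_)
      · exact (MvPolynomial.totalDegree_rename_le _ _).trans hp
      · exact (MvPolynomial.totalDegree_rename_le _ _).trans hq
    · filter_upwards [hF, hG, Lp.coeFn_add F G] with ω h1 h2 h3
      rw [h3, Pi.add_apply, h1, h2, map_add, MvPolynomial.eval_rename, MvPolynomial.eval_rename]
      congr 2 <;> (congr 1; funext i; simp)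
  smul_mem' := by
    rintro c F ⟨m, p, ξ, hp, hF⟩
    refine ⟨m, c • p, ξ, (MvPolynomial.totalDegree_smul_le c p).trans hp, ?_⟩
    filter_upwards [hF, Lp.coeFn_smul c F] with ω h1 h2
    rw [h2, Pi.smul_apply, h1, MvPolynomial.smul_eval, smul_eq_mul]

/-- The `n`-th Wiener chaos: the orthogonal complement of the `L²`-closure of `𝒫ₙ₋₁(H₁)` in the
`L²`-closure of `𝒫ₙ(H₁)` (with `𝒫₋₁(H₁) = 0`). -/
def chaos (H₁ : Submodule ℝ (Lp ℝ 2 P)) : ℕ → Submodule ℝ (Lp ℝ 2 P)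
  | 0 => (polySpace H₁ 0).topologicalClosure
  | n + 1 => (polySpace H₁ (n + 1)).topologicalClosure ⊓ (polySpace H₁ n).topologicalClosureᗮ

theorem isClosed_chaos (H₁ : Submodule ℝ (Lp ℝ 2 P)) (n : ℕ) :
    IsClosed (chaos H₁ n : Set (Lp ℝ 2 P)) := by
  cases n with
  | zero => exact Submodule.isClosed_topologicalClosure _
  | succ n =>
    exact (Submodule.isClosed_topologicalClosure _).inter (Submodule.isClosed_orthogonal _)

instance (H₁ : Submodule ℝ (Lp ℝ 2 P)) (n : ℕ) : CompleteSpace (chaos H₁ n) :=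
  (isClosed_chaos H₁ n).completeSpace_coe

/-- `Jₙ`, the orthogonal projection of `L²(Ω)` onto the `n`-th Wiener chaos. -/
def J (H₁ : Submodule ℝ (Lp ℝ 2 P)) (n : ℕ) : Lp ℝ 2 P →L[ℝ] Lp ℝ 2 P :=
  (chaos H₁ n).starProjection

theorem polySpace_mono (H₁ : Submodule ℝ (Lp ℝ 2 P)) : Monotone (polySpace H₁) := by
  rintro a b hab F ⟨m, p, ξ, hp, hF⟩
  exact ⟨m, p, ξ, hp.trans hab, hF⟩

theorem orthogonalFamily_chaos (H₁ : Submodule ℝ (Lp ℝ 2 P)) :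
    OrthogonalFamily ℝ (fun n => chaos H₁ n) (fun n => (chaos H₁ n).subtypeₗᵢ) := by
  have key : ∀ i j : ℕ, i < j → ∀ (x : chaos H₁ i) (y : chaos H₁ j),
      inner ℝ (x : Lp ℝ 2 P) (y : Lp ℝ 2 P) = 0 := by
    intro i j hij x y
    obtain ⟨k, rfl⟩ : ∃ k, j = k + 1 := ⟨j - 1, by omega⟩
    have hx : (x : Lp ℝ 2 P) ∈ (polySpace H₁ i).topologicalClosure := by
      cases i with
      | zero => exact x.2
      | succ i => exact x.2.1
    have hx' : (x : Lp ℝ 2 P) ∈ (polySpace H₁ k).topologicalClosure :=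
      Submodule.topologicalClosure_mono (polySpace_mono H₁ (by omega)) hx
    exact Submodule.inner_right_of_mem_orthogonal hx' y.2.2
  intro i j hij x y
  rcases lt_or_gt_of_ne hij with h | h
  · exact key i j h x y
  · change inner ℝ (x : Lp ℝ 2 P) (y : Lp ℝ 2 P) = 0
    rw [real_inner_comm]
    exact key j i h y x

/-- On the domain of `L` the series defining `L` converges in `L²(Ω)`. -/
theorem summable_neg_smul_J (H₁ : Submodule ℝ (Lp ℝ 2 P)) {F : Lp ℝ 2 P}
    (hF : Summable fun n : ℕ => (n : ℝ) ^ 2 * ‖J H₁ n F‖ ^ 2) :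
    Summable fun n : ℕ => -(n : ℝ) • J H₁ n F := by
  have h := (orthogonalFamily_chaos H₁).summable_iff_norm_sq_summable
    (fun n => -(n : ℝ) • (chaos H₁ n).orthogonalProjectionOnto F)
  refine h.2 (hF.congr fun n => ?_)
  rw [norm_smul, mul_pow, norm_neg, Real.norm_natCast]
  rfl

theorem tsum_neg_smul_add {E : Type*} [NormedAddCommGroup E] [NormedSpace ℝ E]
    (T : ℕ → E →L[ℝ] E) {x y : E} (hx : Summable fun n : ℕ => -(n : ℝ) • T n x)
    (hy : Summable fun n : ℕ => -(n : ℝ) • T n y) :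
    ∑' n : ℕ, -(n : ℝ) • T n (x + y) =
      (∑' n : ℕ, -(n : ℝ) • T n x) + ∑' n : ℕ, -(n : ℝ) • T n y := by
  rw [← hx.tsum_add hy]
  exact tsum_congr fun n => by rw [map_add, smul_add]

theorem tsum_neg_smul_smul {E : Type*} [NormedAddCommGroup E] [NormedSpace ℝ E]
    (T : ℕ → E →L[ℝ] E) (c : ℝ) {x : E} (hx : Summable fun n : ℕ => -(n : ℝ) • T n x) :
    ∑' n : ℕ, -(n : ℝ) • T n (c • x) = c • ∑' n : ℕ, -(n : ℝ) • T n x := by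
  rw [← hx.tsum_const_smul c]
  exact tsum_congr fun n => by rw [map_smul, smul_comm]

/-- The generator `L` of the Ornstein–Uhlenbeck semigroup, `L F = ∑ₙ -n Jₙ F`, with domain
`{F ∈ L²(Ω) | ∑ₙ n² E[|Jₙ F|²] < ∞}`. -/
def L (H₁ : Submodule ℝ (Lp ℝ 2 P)) : Lp ℝ 2 P →ₗ.[ℝ] Lp ℝ 2 P where
  domain :=
    { carrier := {F | Summable fun n : ℕ => (n : ℝ) ^ 2 * ‖J H₁ n F‖ ^ 2}
      zero_mem' := by simp
      add_mem' := by
        intro F G hF hG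
        refine Summable.of_nonneg_of_le (fun n => by positivity) (fun n => ?_)
          ((hF.add hG).mul_left 2)
        rw [map_add, ← mul_add, mul_left_comm]
        refine mul_le_mul_of_nonneg_left ?_ (by positivity)
        have h := norm_add_le (J H₁ n F) (J H₁ n G)
        nlinarith [sq_nonneg (‖J H₁ n F‖ - ‖J H₁ n G‖), norm_nonneg (J H₁ n F + J H₁ n G)]
      smul_mem' := by
        intro c F hF
        refine (Summable.mul_left (c ^ 2) hF).congr fun n => ?_
        rw [map_smul, norm_smul, mul_pow, Real.norm_eq_abs, sq_abs]
        ring }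
  toFun :=
    { toFun := fun F => ∑' n : ℕ, -(n : ℝ) • J H₁ n F
      map_add' := fun F G =>
        tsum_neg_smul_add (J H₁) (summable_neg_smul_J H₁ F.2) (summable_neg_smul_J H₁ G.2)
      map_smul' := fun c F => tsum_neg_smul_smul (J H₁) c (summable_neg_smul_J H₁ F.2) }

end Chaos

section Derivative

variable {Ω : Type*} [MeasurableSpace Ω] {P : Measure Ω}
variable {H : Type*} [NormedAddCommGroup H] [InnerProductSpace ℝ H]
variable {H₁ : Submodule ℝ (Lp ℝ 2 P)}

theorem pderiv_rename_add {σ τ υ : Type*} {f : σ → υ} {g : τ → υ} (hf : f.Injective)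
    (hfg : ∀ s t, f s ≠ g t) (p : MvPolynomial σ ℝ) (q : MvPolynomial τ ℝ) (s : σ) :
    MvPolynomial.pderiv (f s) (MvPolynomial.rename f p + MvPolynomial.rename g q) =
      MvPolynomial.rename f (MvPolynomial.pderiv s p) := by
  classical
  have hq : MvPolynomial.pderiv (f s) (MvPolynomial.rename g q) = 0 := by
    refine MvPolynomial.pderiv_eq_zero_of_notMem_vars fun h => ?_
    obtain ⟨t, -, ht⟩ := Finset.mem_image.1 (MvPolynomial.vars_rename g q h)
    exact hfg s t ht.symm
  rw [map_add, MvPolynomial.pderiv_rename hf, hq, add_zero]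

/-- The graph of the derivative on polynomials: the pairs `(F, DF)` with
`F = p(W(h₁), …, W(hₘ))` and `DF = ∑ᵢ ∂ᵢp(W(h₁), …, W(hₘ)) hᵢ`. -/
def polyGraph (W : H ≃ₗᵢ[ℝ] H₁) : Submodule ℝ (Lp ℝ 2 P × Lp H 2 P) where
  carrier := {FU | ∃ (m : ℕ) (p : MvPolynomial (Fin m) ℝ) (h : Fin m → H),
    ((FU.1 : Ω → ℝ) =ᵐ[P] fun ω =>
      MvPolynomial.eval (fun i => (W (h i) : Lp ℝ 2 P) ω) p) ∧
    ((FU.2 : Ω → H) =ᵐ[P] fun ω => ∑ j,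
      MvPolynomial.eval (fun i => (W (h i) : Lp ℝ 2 P) ω) (MvPolynomial.pderiv j p) • h j)}
  zero_mem' := ⟨0, 0, 0, by
      filter_upwards [Lp.coeFn_zero ℝ 2 P] with ω h
      simpa using h, by
      filter_upwards [Lp.coeFn_zero H 2 P] with ω h
      simpa using h⟩
  add_mem' := by
    rintro ⟨F, U⟩ ⟨G, V⟩ ⟨m, p, h, hF, hU⟩ ⟨k, q, l, hG, hV⟩
    refine ⟨m + k, MvPolynomial.rename (Fin.castAdd k) p + MvPolynomial.rename (Fin.natAdd m) q,
      Fin.append h l, ?_, ?_⟩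
    · filter_upwards [hF, hG, Lp.coeFn_add F G] with ω h1 h2 h3
      change (F + G : Lp ℝ 2 P) ω = _
      rw [h3, Pi.add_apply, h1, h2, map_add, MvPolynomial.eval_rename, MvPolynomial.eval_rename]
      congr 2 <;> (congr 1; funext i; simp)
    · filter_upwards [hU, hV, Lp.coeFn_add U V] with ω h1 h2 h3
      change (U + V : Lp H 2 P) ω = _
      rw [h3, Pi.add_apply, h1, h2, Fin.sum_univ_add]
      congr 1 <;> refine Finset.sum_congr rfl fun j _ => ?_
      · rw [pderiv_rename_add (Fin.castAdd_injective m k)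
          (fun s t hst => by have := congrArg Fin.val hst; simp at this; omega),
          MvPolynomial.eval_rename, Fin.append_left]
        congr 3
        funext i; simp
      · rw [add_comm (MvPolynomial.rename _ p), pderiv_rename_add (Fin.natAdd_injective k m)
          (fun s t hst => by have := congrArg Fin.val hst; simp at this; omega),
          MvPolynomial.eval_rename, Fin.append_right]
        congr 3
        funext i; simp
  smul_mem' := by
    rintro c ⟨F, U⟩ ⟨m, p, h, hF, hU⟩
    refine ⟨m, c • p, h, ?_, ?_⟩
    · filter_upwards [hF, Lp.coeFn_smul c F] with ω h1 h2
      change (c • F : Lp ℝ 2 P) ω = _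
      rw [h2, Pi.smul_apply, h1, MvPolynomial.smul_eval, smul_eq_mul]
    · filter_upwards [hU, Lp.coeFn_smul c U] with ω h1 h2
      change (c • U : Lp H 2 P) ω = _
      rw [h2, Pi.smul_apply, h1, Finset.smul_sum]
      refine Finset.sum_congr rfl fun j _ => ?_
      rw [Derivation.map_smul, MvPolynomial.smul_eval, mul_smul]

/-- The Malliavin derivative `D : 𝔻^{1,2} ⊆ L²(Ω) → L²(Ω; H)`: the closed operator whose graph is
the closure of the graph of the derivative on polynomials. Its domain `𝔻^{1,2}` consists of the
`F ∈ L²(Ω)` for which there are polynomial random variables `Fₙ → F` in `L²(Ω)` with `DFₙ`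
convergent in `L²(Ω; H)`. -/
def D (W : H ≃ₗᵢ[ℝ] H₁) : Lp ℝ 2 P →ₗ.[ℝ] Lp H 2 P :=
  (polyGraph W).topologicalClosure.toLinearPMap

/-- The divergence operator `δ`: the (unbounded) Hilbert space adjoint of `D`. Its domain consists
of the `u ∈ L²(Ω; H)` for which `F ↦ E⟨DF, u⟩` is continuous on `𝔻^{1,2}` in the `L²(Ω)`-norm, and
`E[F δ(u)] = E⟨DF, u⟩` for all `F ∈ 𝔻^{1,2}`. -/
def δ [CompleteSpace H] (W : H ≃ₗᵢ[ℝ] H₁) : Lp H 2 P →ₗ.[ℝ] Lp ℝ 2 P :=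
  (D W).adjoint

end Derivative

end Malliavin

end

/-! Both sides of the equivalence describe one linear relation on `Lp ℝ 2 P`. Let `R` be the
relation `D* D`, with `D` the closure of `polyGraph W`. It is symmetric, and closed because `‖DF‖² =
⟨F, D*DF⟩` controls the middle term (`isClosed_adjointComp`). Gaussian integration by parts
(`polyExp_mul_X`) makes `R` explicit on polynomials: it acts as the Euler operator minus a
second-order term. By Euler's identity this is multiplication by `n` on polynomials of degree at
most `n`, modulo lower degree (`isNumberRelation_adjointComp`).

These properties already determine `R`. Triangularity splits each polynomial into polynomial
eigenvectors with eigenvalues `0, …, n`; symmetry makes these orthogonal, so they lie in the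
chaoses; closedness extends the eigenvalue equation to each whole chaos. Since polynomials are total
(`eq_zero_of_forall_inner_polySpace`), the chaos expansion holds and `R` is the graph of `-L`
(`IsNumberRelation.mem_iff`). Hermite polynomials are never needed. Closability of `D` and density
of its domain then translate `R` into the operators `D` and `δ` (`mem_adjointComp_iff`). -/

noncomputable section

namespace Malliavin

/-! ### Number relations and the chaos expansion. -/

section ChaosExpansion

variable {Ω : Type*} [MeasurableSpace Ω] {P : Measure Ω} {H₁ : Submodule ℝ (Lp ℝ 2 P)}

/-- A closed symmetric relation on `L²(Ω)` which acts on polynomials of degree at most `n` as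
multiplication by `n` up to polynomials of lower degree. -/
structure IsNumberRelation (H₁ : Submodule ℝ (Lp ℝ 2 P))
    (R : Submodule ℝ (Lp ℝ 2 P × Lp ℝ 2 P)) : Prop where
  isClosed : IsClosed (R : Set (Lp ℝ 2 P × Lp ℝ 2 P))
  symmetric : ∀ x ∈ R, ∀ y ∈ R, inner ℝ x.2 y.1 = inner ℝ x.1 y.2
  zero : ∀ F ∈ polySpace H₁ 0, (F, 0) ∈ R
  succ : ∀ n : ℕ, ∀ F ∈ polySpace H₁ (n + 1), ∃ G, (F, G) ∈ R ∧
    G - ((n + 1 : ℕ) : ℝ) • F ∈ polySpace H₁ n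

theorem J_of_mem_chaos {n : ℕ} {F : Lp ℝ 2 P} (hF : F ∈ chaos H₁ n) : J H₁ n F = F :=
  Submodule.starProjection_eq_self_iff.2 hF

theorem J_mem_chaos (n : ℕ) (F : Lp ℝ 2 P) : J H₁ n F ∈ chaos H₁ n :=
  Submodule.starProjection_apply_mem _ _

theorem J_of_mem_chaos_of_ne {m n : ℕ} (hmn : m ≠ n) {F : Lp ℝ 2 P} (hF : F ∈ chaos H₁ m) :
    J H₁ n F = 0 := by
  refine (Submodule.starProjection_apply_eq_zero_iff _).2 fun G hG => ?_
  exact (orthogonalFamily_chaos H₁) hmn.symm ⟨G, hG⟩ ⟨F, hF⟩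

theorem inner_J_of_mem_chaos {n : ℕ} (F : Lp ℝ 2 P) {G : Lp ℝ 2 P} (hG : G ∈ chaos H₁ n) :
    inner ℝ (J H₁ n F) G = inner ℝ F G := by
  conv_rhs => rw [← J_of_mem_chaos hG]
  exact Submodule.inner_starProjection_left_eq_right _ _ _

theorem chaos_le_closure_polySpace (n : ℕ) :
    chaos H₁ n ≤ (polySpace H₁ n).topologicalClosure := by
  cases n with
  | zero => exact le_rfl
  | succ n => exact inf_le_left

namespace IsNumberRelation

variable {R : Submodule ℝ (Lp ℝ 2 P × Lp ℝ 2 P)} (hR : IsNumberRelation H₁ R)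
include hR

/-- A polynomial of degree at most `n` is a sum of polynomial eigenvectors. -/
theorem exists_eigen_decomposition (n : ℕ) : ∀ F ∈ polySpace H₁ n, ∃ e : ℕ → Lp ℝ 2 P,
    (∀ k, e k ∈ polySpace H₁ k ∧ (e k, (k : ℝ) • e k) ∈ R) ∧
      F = ∑ k ∈ Finset.range (n + 1), e k := by
  induction n with
  | zero =>
    intro F hF
    refine ⟨fun k => if k = 0 then F else 0, fun k => ?_, by simp⟩
    by_cases hk : k = 0
    · subst hk
      simpa using ⟨hF, hR.zero F hF⟩
    · simp only [hk, if_false, smul_zero]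
      exact ⟨zero_mem _, R.zero_mem⟩
  | succ n ih =>
    intro F hF
    obtain ⟨G, hG, hGF⟩ := hR.succ n F hF
    obtain ⟨e, he, hsum⟩ := ih _ hGF
    -- The correction `∑ c k • e k` turns `F` into an eigenvector `T` with eigenvalue `n + 1`: this
    -- requires `(n + 1) * c k = 1 + k * c k`, solvable because `k < n + 1`.
    set c : ℕ → ℝ := fun k => ((n + 1 : ℝ) - k)⁻¹ with hc
    have hcn : ∀ k ∈ Finset.range (n + 1), c k * ((n + 1 : ℝ) - k) = 1 := fun k hk => by
      have : (k : ℝ) < n + 1 := by exact_mod_cast Finset.mem_range.1 hk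
      exact inv_mul_cancel₀ (by linarith)
    set T := F + ∑ k ∈ Finset.range (n + 1), c k • e k with hT
    have hTP : T ∈ polySpace H₁ (n + 1) := by
      refine add_mem hF (sum_mem fun k hk => Submodule.smul_mem _ _ ?_)
      exact polySpace_mono H₁ (Finset.mem_range.1 hk).le (he k).1
    have hTR : (T, ((n + 1 : ℕ) : ℝ) • T) ∈ R := by
      have h1 : (F, G) + ∑ k ∈ Finset.range (n + 1), c k • (e k, (k : ℝ) • e k) ∈ R :=
        add_mem hG (sum_mem fun k _ => Submodule.smul_mem _ _ (he k).2)
      convert h1 using 1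
      refine Prod.ext ?_ ?_
      · simp [hT, Prod.fst_sum]
      · rw [Prod.snd_add, Prod.snd_sum, hT, smul_add, ← sub_eq_zero]
        have h2 : G = ((n + 1 : ℕ) : ℝ) • F + ∑ k ∈ Finset.range (n + 1), e k := by
          rw [← hsum]; abel
        change _ - (G + _) = 0
        rw [h2, Finset.smul_sum, add_assoc, add_sub_add_left_eq_sub, ← Finset.sum_add_distrib,
          ← Finset.sum_sub_distrib]
        refine Finset.sum_eq_zero fun k hk => ?_
        have h3 := hcn k hk
        change _ - (e k + c k • ((k : ℝ) • e k)) = 0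
        have h4 : ((n + 1 : ℕ) : ℝ) * c k = 1 + c k * k := by
          push_cast
          linear_combination h3
        rw [smul_smul, smul_smul, h4, add_smul, one_smul, sub_self]
    refine ⟨fun k => if k ∈ Finset.range (n + 1) then -(c k) • e k else
      if k = n + 1 then T else 0, fun k => ?_, ?_⟩
    · by_cases hk : k ∈ Finset.range (n + 1)
      · simp only [hk, if_true]
        refine ⟨Submodule.smul_mem _ _ (he k).1, ?_⟩
        rw [smul_comm]
        exact R.smul_mem (-(c k)) (he k).2
      · simp only [hk, if_false]
        by_cases hk' : k = n + 1
        · subst hk'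
          simpa using ⟨hTP, by simpa using hTR⟩
        · simp only [hk', if_false, smul_zero]
          exact ⟨zero_mem _, R.zero_mem⟩
    · rw [Finset.sum_range_succ, Finset.sum_congr rfl fun k hk => if_pos hk]
      simp [hT]

theorem inner_eq_zero_of_eigen {m n : ℕ} (hmn : m ≠ n) {x y : Lp ℝ 2 P}
    (hx : (x, (m : ℝ) • x) ∈ R) (hy : (y, (n : ℝ) • y) ∈ R) : inner ℝ x y = 0 := by
  have h := hR.symmetric _ hx _ hy
  simp only [real_inner_smul_left, real_inner_smul_right] at h
  have hmn' : (m : ℝ) - n ≠ 0 := sub_ne_zero.2 (by exact_mod_cast hmn)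
  exact (mul_eq_zero.1 (by linear_combination h : ((m : ℝ) - n) * inner ℝ x y = 0)).resolve_left hmn'

/-- Polynomials of lower degree are sums of eigenvectors with smaller eigenvalues, to which `x` is
orthogonal by symmetry. -/
theorem mem_chaos_of_eigen {n : ℕ} {x : Lp ℝ 2 P} (hx : x ∈ polySpace H₁ n)
    (hxR : (x, (n : ℝ) • x) ∈ R) : x ∈ chaos H₁ n := by
  have hx' := Submodule.le_topologicalClosure _ hx
  cases n with
  | zero => exact hx'
  | succ n =>
    refine ⟨hx', ?_⟩
    rw [SetLike.mem_coe, Submodule.orthogonal_closure, Submodule.mem_orthogonal]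
    intro F hF
    obtain ⟨e, he, rfl⟩ := hR.exists_eigen_decomposition n F hF
    rw [sum_inner]
    exact Finset.sum_eq_zero fun k hk =>
      hR.inner_eq_zero_of_eigen (Finset.mem_range.1 hk).ne (he k).2 hxR

/-- On a polynomial, `J H₁ n` picks out the last term of the eigenvector decomposition. -/
theorem J_eigen_of_mem_polySpace {n : ℕ} {F : Lp ℝ 2 P} (hF : F ∈ polySpace H₁ n) :
    (J H₁ n F, (n : ℝ) • J H₁ n F) ∈ R := by
  obtain ⟨e, he, rfl⟩ := hR.exists_eigen_decomposition n F hF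
  have h : J H₁ n (∑ k ∈ Finset.range (n + 1), e k) = e n := by
    rw [map_sum, Finset.sum_eq_single n]
    · exact J_of_mem_chaos (hR.mem_chaos_of_eigen (he n).1 (he n).2)
    · exact fun k _ hk => J_of_mem_chaos_of_ne hk (hR.mem_chaos_of_eigen (he k).1 (he k).2)
    · simp
  rw [h]
  exact (he n).2

/-- An element of the chaos is only a limit of polynomials; projecting these by `J H₁ n` gives
eigenvectors with the same limit, and `R` is closed. -/
theorem eigen_of_mem_chaos {n : ℕ} {F : Lp ℝ 2 P} (hF : F ∈ chaos H₁ n) :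
    (F, (n : ℝ) • F) ∈ R := by
  have hcl : IsClosed {G : Lp ℝ 2 P | (J H₁ n G, (n : ℝ) • J H₁ n G) ∈ R} :=
    hR.isClosed.preimage (f := fun G : Lp ℝ 2 P => (J H₁ n G, (n : ℝ) • J H₁ n G)) (by fun_prop)
  have h : F ∈ {G : Lp ℝ 2 P | (J H₁ n G, (n : ℝ) • J H₁ n G) ∈ R} :=
    closure_minimal (fun G hG => hR.J_eigen_of_mem_polySpace hG) hcl
      (chaos_le_closure_polySpace n hF)
  rwa [Set.mem_ofPred_eq, J_of_mem_chaos hF] at h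

variable (htot : ∀ x : Lp ℝ 2 P, (∀ n, ∀ p ∈ polySpace H₁ n, inner ℝ p x = 0) → x = 0)
include htot

/-- The Wiener chaos expansion. -/
theorem hasSum_J (x : Lp ℝ 2 P) : HasSum (fun n => J H₁ n x) x := by
  have htop : ⊤ ≤ (⨆ n, chaos H₁ n).topologicalClosure := by
    rw [top_le_iff, Submodule.topologicalClosure_eq_top_iff, Submodule.eq_bot_iff]
    refine fun y hy => htot y fun n p hp => ?_
    obtain ⟨e, he, rfl⟩ := hR.exists_eigen_decomposition n p hp
    refine (Submodule.mem_orthogonal _ _).1 hy _ (sum_mem fun k _ => ?_)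
    exact Submodule.mem_iSup_of_mem k (hR.mem_chaos_of_eigen (he k).1 (he k).2)
  have hH := IsHilbertSum.mkInternal _ (orthogonalFamily_chaos H₁) htop
  have hw := hH.hasSum_linearIsometryEquiv_symm (hH.linearIsometryEquiv x)
  rw [LinearIsometryEquiv.symm_apply_apply] at hw
  set w := hH.linearIsometryEquiv x
  convert hw using 2 with n
  -- Applying `J H₁ n` termwise to the abstract expansion leaves only its `n`-th component.
  have h1 := hw.mapL (J H₁ n)
  change J H₁ n x = (w n : Lp ℝ 2 P)
  refine h1.unique ?_
  convert hasSum_ite_eq n (w n : Lp ℝ 2 P) using 2 with k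
  split_ifs with hk
  · subst hk
    exact J_of_mem_chaos (w k).2
  · exact J_of_mem_chaos_of_ne hk (w k).2

/-- Symmetry against the eigenvectors `z` of the `n`-th chaos gives `J H₁ n y = n • J H₁ n x`; the
series is then the expansion of `y`. -/
theorem hasSum_smul_J_of_mem {x y : Lp ℝ 2 P} (hxy : (x, y) ∈ R) :
    HasSum (fun n : ℕ => (n : ℝ) • J H₁ n x) y := by
  convert hR.hasSum_J htot y using 2 with n
  have h : ∀ z ∈ chaos H₁ n, inner ℝ ((n : ℝ) • J H₁ n x - J H₁ n y) z = 0 := fun z hz => by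
    have := hR.symmetric _ hxy _ (hR.eigen_of_mem_chaos hz)
    simp only [real_inner_smul_right] at this
    rw [inner_sub_left, real_inner_smul_left, inner_J_of_mem_chaos _ hz, inner_J_of_mem_chaos _ hz,
      this, sub_self]
  exact sub_eq_zero.1 (inner_self_eq_zero.1 (h _ (sub_mem
    (Submodule.smul_mem _ _ (J_mem_chaos n x)) (J_mem_chaos n y))))

/-- A number relation is the graph of `-L`. -/
theorem mem_iff {x y : Lp ℝ 2 P} :
    (x, y) ∈ R ↔ ∃ hx : x ∈ (L H₁).domain, y = -(L H₁ ⟨x, hx⟩) := by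
  have hL : ∀ hx : x ∈ (L H₁).domain,
      -(L H₁ ⟨x, hx⟩) = ∑' n : ℕ, (n : ℝ) • J H₁ n x := fun hx => by
    change -(∑' n : ℕ, -(n : ℝ) • J H₁ n x) = _
    simp only [neg_smul, tsum_neg, neg_neg]
  constructor
  · intro hxy
    have hs := hR.hasSum_smul_J_of_mem htot hxy
    have hx : x ∈ (L H₁).domain := by
      have h := ((orthogonalFamily_chaos H₁).summable_iff_norm_sq_summable
        (fun n => (n : ℝ) • (chaos H₁ n).orthogonalProjectionOnto x)).1 hs.summable
      refine h.congr fun n => ?_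
      rw [norm_smul, mul_pow, Real.norm_natCast]
      rfl
    exact ⟨hx, by rw [hL hx, hs.tsum_eq]⟩
  · rintro ⟨hx, rfl⟩
    rw [hL hx]
    have hs : HasSum (fun n : ℕ => (n : ℝ) • J H₁ n x) (∑' n : ℕ, (n : ℝ) • J H₁ n x) := by
      refine Summable.hasSum ?_
      simpa only [neg_smul, neg_neg] using (summable_neg_smul_J H₁ hx).neg
    -- The partial sums of both series form pairs in `R`, so closedness captures the limit pair.
    have h2 := (hR.hasSum_J htot x).prodMk hs
    refine hR.isClosed.mem_of_tendsto h2 (Filter.Eventually.of_forall fun s => ?_)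
    exact sum_mem fun n _ => hR.eigen_of_mem_chaos (J_mem_chaos n x)

end IsNumberRelation

end ChaosExpansion

/-! ### Polarization for linear functionals on algebras. -/

section Polarization

variable {A : Type*} [CommRing A] [Algebra ℝ A]

/-- No topology on `A` is involved: after applying `φ` the expression is a real polynomial in `s`.
Serves both polarization and Gaussian integration by parts. -/
theorem hasDerivAt_linearMap_pow_mul (φ : A →ₗ[ℝ] ℝ) (x y : A) (n : ℕ) (q : A) (t : ℝ) :
    HasDerivAt (fun s : ℝ => φ ((x + s • y) ^ (n + 1) * q))
      ((n + 1) * φ ((x + t • y) ^ n * (y * q))) t := by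
  have expand : ∀ (m : ℕ) (r : A) (s : ℝ), φ ((x + s • y) ^ (m + 1) * r) =
      φ ((x + s • y) ^ m * (x * r)) + s * φ ((x + s • y) ^ m * (y * r)) := fun m r s => by
    rw [← smul_eq_mul s, ← map_smul, ← map_add]
    congr 1
    rw [pow_succ, mul_assoc, add_mul, mul_add, smul_mul_assoc, mul_smul_comm]
  induction n generalizing q with
  | zero =>
    have h : (fun s : ℝ => φ ((x + s • y) ^ (0 + 1) * q)) =
        fun s => φ (x * q) + s * φ (y * q) := by
      funext s
      rw [expand, pow_zero, one_mul, one_mul]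
    rw [h]
    simpa using ((hasDerivAt_id t).mul_const (φ (y * q))).const_add (φ (x * q))
  | succ n ih =>
    have h : (fun s : ℝ => φ ((x + s • y) ^ (n + 1 + 1) * q)) = fun s =>
        φ ((x + s • y) ^ (n + 1) * (x * q)) + s * φ ((x + s • y) ^ (n + 1) * (y * q)) := by
      funext s
      exact expand _ _ _
    rw [h]
    have h1 := (ih (x * q)).add ((hasDerivAt_id t).mul (ih (y * q)))
    refine h1.congr_deriv ?_
    have h2 := expand n (y * q) t
    rw [mul_left_comm y x q]
    push_cast
    simp only [id]
    linear_combination (-(n : ℝ) - 1) * h2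

/-- Polarization: a linear functional which vanishes on the powers of the elements of a subspace
vanishes on the products of elements of this subspace. -/
theorem linearMap_pow_mul_prod_eq_zero (φ : A →ₗ[ℝ] ℝ) (M : Submodule ℝ A)
    (hφ : ∀ x ∈ M, ∀ n : ℕ, φ (x ^ n) = 0) (l : List A) (hl : ∀ y ∈ l, y ∈ M) :
    ∀ x ∈ M, ∀ n : ℕ, φ (x ^ n * l.prod) = 0 := by
  induction l with
  | nil => simpa using hφ
  | cons y l ih =>
    intro x hx n
    have ih' := ih fun z hz => hl z (List.mem_cons_of_mem _ hz)
    -- The function of `s` vanishes identically by induction, so its derivative at `0`, which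
    -- carries the extra factor `y`, vanishes too.
    have h := hasDerivAt_linearMap_pow_mul φ x y n l.prod 0
    have h0 : (fun s : ℝ => φ ((x + s • y) ^ (n + 1) * l.prod)) = fun _ => 0 := by
      funext s
      exact ih' _ (add_mem hx (Submodule.smul_mem _ _ (hl y (List.mem_cons_self)))) _
    rw [h0] at h
    have h1 := h.unique (hasDerivAt_const (0 : ℝ) (0 : ℝ))
    rw [zero_smul, add_zero] at h1
    rw [List.prod_cons]
    exact (mul_eq_zero.1 h1).resolve_left (by positivity)

theorem linearMap_mvPolynomial_eq_zero {σ : Type*} (φ : MvPolynomial σ ℝ →ₗ[ℝ] ℝ)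
    (hφ : ∀ x ∈ Submodule.span ℝ (Set.range (MvPolynomial.X : σ → MvPolynomial σ ℝ)), ∀ n : ℕ,
      φ (x ^ n) = 0) (p : MvPolynomial σ ℝ) : φ p = 0 := by
  -- The list `l` absorbs variables one at a time, so that the induction on `p` ends at constants.
  have h : ∀ (p : MvPolynomial σ ℝ) (l : List σ), φ (p * (l.map MvPolynomial.X).prod) = 0 := by
    intro p
    induction p using MvPolynomial.induction_on with
    | C a =>
      intro l
      rw [← MvPolynomial.smul_eq_C_mul, map_smul]
      have := linearMap_pow_mul_prod_eq_zero φ _ hφ (l.map MvPolynomial.X) (fun y hy => by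
        obtain ⟨i, -, rfl⟩ := List.mem_map.1 hy
        exact Submodule.subset_span ⟨i, rfl⟩) 0 (zero_mem _) 0
      rw [pow_zero, one_mul] at this
      rw [this, smul_zero]
    | add p q hp hq => exact fun l => by rw [add_mul, map_add, hp, hq, add_zero]
    | mul_X p i hp => exact fun l => by simpa [mul_assoc] using hp (i :: l)
  simpa using h p []

end Polarization

/-! ### Gaussian moments. -/

section Moments

/-- Repeated differentiation of `f' = v t f`. At `t = 0` it becomes the moment recursion, `f` being
the moment generating function. -/
theorem iteratedDeriv_exp_mul_sq (v : ℝ) (n : ℕ) :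
    iteratedDeriv (n + 2) (fun t : ℝ => Real.exp (v * t ^ 2 / 2)) = fun t =>
      v * t * iteratedDeriv (n + 1) (fun t : ℝ => Real.exp (v * t ^ 2 / 2)) t +
        (n + 1) * v * iteratedDeriv n (fun t : ℝ => Real.exp (v * t ^ 2 / 2)) t := by
  set f : ℝ → ℝ := fun t => Real.exp (v * t ^ 2 / 2) with hf
  have hsmooth : ContDiff ℝ ⊤ f := by fun_prop
  have hder : ∀ (k : ℕ) (t : ℝ), HasDerivAt (iteratedDeriv k f) (iteratedDeriv (k + 1) f t) t := by
    intro k t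
    rw [iteratedDeriv_succ]
    exact (hsmooth.differentiable_iteratedDeriv k (WithTop.coe_lt_top _) t).hasDerivAt
  have h1 : iteratedDeriv 1 f = fun t => v * t * f t := by
    funext t
    rw [iteratedDeriv_one]
    have h : HasDerivAt f (Real.exp (v * t ^ 2 / 2) * (v * (2 * t) / 2)) t := by
      refine HasDerivAt.exp (HasDerivAt.div_const (HasDerivAt.const_mul v ?_) 2)
      simpa using hasDerivAt_pow 2 t
    rw [h.deriv, hf]
    ring
  have hlin : ∀ t : ℝ, HasDerivAt (fun s : ℝ => v * s) v t := fun t => by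
    simpa using (hasDerivAt_id t).const_mul v
  induction n with
  | zero =>
    funext t
    have h2 : HasDerivAt (fun t => v * t * f t) (iteratedDeriv 2 f t) t := by
      rw [← h1]; exact hder 1 t
    have h3 := (hlin t).mul (by simpa using hder 0 t : HasDerivAt f (iteratedDeriv 1 f t) t)
    rw [zero_add, h2.unique h3]
    simp
    ring
  | succ n ih =>
    funext t
    have h2 := hder (n + 2) t
    rw [ih] at h2
    have h3 := ((hlin t).mul (hder (n + 1) t)).add ((hder n t).const_mul ((n + 1) * v))
    rw [show n + 1 + 2 = n + 2 + 1 from rfl, h2.unique h3]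
    push_cast
    ring

theorem integral_pow_add_two_gaussianReal (v : ℝ≥0) (n : ℕ) :
    ∫ x, x ^ (n + 2) ∂gaussianReal 0 v = (n + 1) * v * ∫ x, x ^ n ∂gaussianReal 0 v := by
  have h : ∀ k : ℕ, ∫ x, x ^ k ∂gaussianReal 0 v =
      iteratedDeriv k (fun t : ℝ => Real.exp ((v : ℝ) * t ^ 2 / 2)) 0 := fun k => by
    have := iteratedDeriv_mgf_zero (X := id) (μ := gaussianReal 0 v) (by
      rw [integrableExpSet_id_gaussianReal]; simp) k
    rw [mgf_id_gaussianReal] at this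
    simp only [zero_mul, zero_add] at this
    rw [this]
    rfl
  rw [h, h, iteratedDeriv_exp_mul_sq]
  simp

end Moments

/-! ### Polynomial random variables and Gaussian integration by parts. -/

section PolynomialVariables

variable {Ω : Type*} [MeasurableSpace Ω] {P : Measure Ω}
variable {H₁ : Submodule ℝ (Lp ℝ 2 P)}
variable {H : Type*} [NormedAddCommGroup H] [InnerProductSpace ℝ H] (W : H ≃ₗᵢ[ℝ] H₁)

/-- The polynomial random variable `p(W(h₁), …, W(hₘ))`, for a polynomial in variables indexed
by the elements of `H`. -/
def polyVar (p : MvPolynomial H ℝ) (ω : Ω) : ℝ :=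
  MvPolynomial.eval (fun h => (W h : Lp ℝ 2 P) ω) p

@[simp]
theorem polyVar_C (a : ℝ) (ω : Ω) : polyVar W (MvPolynomial.C a) ω = a := by
  simp [polyVar]

@[simp]
theorem polyVar_X (h : H) (ω : Ω) : polyVar W (MvPolynomial.X h) ω = (W h : Lp ℝ 2 P) ω := by
  simp [polyVar]

@[simp]
theorem polyVar_add (p q : MvPolynomial H ℝ) (ω : Ω) :
    polyVar W (p + q) ω = polyVar W p ω + polyVar W q ω :=
  map_add _ _ _

@[simp]
theorem polyVar_sub (p q : MvPolynomial H ℝ) (ω : Ω) :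
    polyVar W (p - q) ω = polyVar W p ω - polyVar W q ω :=
  map_sub _ _ _

@[simp]
theorem polyVar_mul (p q : MvPolynomial H ℝ) (ω : Ω) :
    polyVar W (p * q) ω = polyVar W p ω * polyVar W q ω :=
  map_mul _ _ _

@[simp]
theorem polyVar_smul (c : ℝ) (p : MvPolynomial H ℝ) (ω : Ω) :
    polyVar W (c • p) ω = c * polyVar W p ω :=
  MvPolynomial.smul_eval _ _ _

@[simp]
theorem polyVar_pow (p : MvPolynomial H ℝ) (n : ℕ) (ω : Ω) :
    polyVar W (p ^ n) ω = polyVar W p ω ^ n :=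
  map_pow _ _ _

theorem polyVar_sum {ι : Type*} (s : Finset ι) (p : ι → MvPolynomial H ℝ) (ω : Ω) :
    polyVar W (∑ i ∈ s, p i) ω = ∑ i ∈ s, polyVar W (p i) ω :=
  map_sum _ _ _

theorem polyVar_rename {m : ℕ} (k : Fin m → H) (p : MvPolynomial (Fin m) ℝ) (ω : Ω) :
    polyVar W (MvPolynomial.rename k p) ω =
      MvPolynomial.eval (fun i => (W (k i) : Lp ℝ 2 P) ω) p :=
  MvPolynomial.eval_rename _ _ _

theorem integral_W_sq (h : H) : ∫ ω, (W h : Lp ℝ 2 P) ω ^ 2 ∂P = ‖h‖ ^ 2 := by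
  have h1 : ‖h‖ ^ 2 = inner ℝ (W h : Lp ℝ 2 P) (W h : Lp ℝ 2 P) := by
    rw [real_inner_self_eq_norm_sq, Submodule.norm_coe, W.norm_map]
  rw [h1, L2.inner_def]
  simp [pow_two]

variable [IsProbabilityMeasure P] (hH₁ : IsGaussianHilbertSpace H₁)
include hH₁

-- The variance is read off from the second moment, which the isometry `W` fixes.
omit [IsProbabilityMeasure P] in
theorem map_W (h : H) : P.map (W h : Lp ℝ 2 P) = gaussianReal 0 (‖h‖₊ ^ 2) := by
  obtain ⟨v, hv⟩ := hH₁.gaussian _ (W h).2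
  have hm : AEMeasurable (W h : Lp ℝ 2 P) P := (Lp.aestronglyMeasurable _).aemeasurable
  have h1 := integral_W_sq W h
  have h2 : ∫ x, x ^ 2 ∂P.map (W h : Lp ℝ 2 P) = ∫ ω, (W h : Lp ℝ 2 P) ω ^ 2 ∂P :=
    integral_map hm (by fun_prop)
  rw [h1, hv, integral_pow_add_two_gaussianReal v 0] at h2
  rw [hv]
  congr 1
  apply NNReal.eq
  simpa using h2

omit [IsProbabilityMeasure P] in
theorem memLp_W (h : H) {q : ℝ≥0∞} (hq : q ≠ ∞) : MemLp (W h : Lp ℝ 2 P) q P := by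
  have hm : AEMeasurable (W h : Lp ℝ 2 P) P := (Lp.aestronglyMeasurable _).aemeasurable
  have h1 := memLp_id_gaussianReal' (μ := 0) (v := ‖h‖₊ ^ 2) q hq
  rw [← map_W W hH₁ h] at h1
  exact h1.comp_of_map hm

/-- All finite exponents are treated together because Hölder's inequality doubles the exponent at
each multiplication. -/
theorem memLp_polyVar (p : MvPolynomial H ℝ) :
    ∀ {q : ℝ≥0∞}, q ≠ ∞ → MemLp (polyVar W p) q P := by
  induction p using MvPolynomial.induction_on with
  | C a =>
    intro q _
    have h : polyVar W (MvPolynomial.C a) = fun _ => a := funext (polyVar_C W a)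
    exact h ▸ memLp_const a
  | add p r hp hr =>
    intro q hq
    have h : polyVar W (p + r) = polyVar W p + polyVar W r := funext (polyVar_add W p r)
    exact h ▸ (hp hq).add (hr hq)
  | mul_X p h hp =>
    intro q hq
    have h2 : 2 * q ≠ ∞ := ENNReal.mul_ne_top (by simp) hq
    have : ENNReal.HolderTriple (2 * q) (2 * q) q := ⟨by
      rw [ENNReal.mul_inv (by simp) (by simp), ← add_mul, ENNReal.inv_two_add_inv_two, one_mul]⟩
    have h3 : polyVar W (p * MvPolynomial.X h) =
        fun ω => polyVar W p ω * (W h : Lp ℝ 2 P) ω := by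
      funext ω
      simp
    exact h3 ▸ (memLp_W W hH₁ h h2).mul' (r := q) (hp h2)

theorem integrable_polyVar (p : MvPolynomial H ℝ) : Integrable (polyVar W p) P :=
  memLp_one_iff_integrable.1 (memLp_polyVar W hH₁ p (by simp))

/-- The expectation of a polynomial random variable. -/
def polyExp : MvPolynomial H ℝ →ₗ[ℝ] ℝ where
  toFun p := ∫ ω, polyVar W p ω ∂P
  map_add' p q := by
    rw [← integral_add (integrable_polyVar W hH₁ p) (integrable_polyVar W hH₁ q)]
    simp [polyVar]
  map_smul' c p := by
    rw [RingHom.id_apply, smul_eq_mul, ← integral_const_mul]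
    simp [polyVar, MvPolynomial.smul_eval]

theorem polyExp_apply (p : MvPolynomial H ℝ) :
    polyExp W hH₁ p = ∫ ω, polyVar W p ω ∂P :=
  rfl

theorem polyExp_congr {p q : MvPolynomial H ℝ} (h : polyVar W p =ᵐ[P] polyVar W q) :
    polyExp W hH₁ p = polyExp W hH₁ q :=
  integral_congr_ae h

theorem polyExp_X_pow_add_two (h : H) (n : ℕ) :
    polyExp W hH₁ (MvPolynomial.X h ^ (n + 2)) =
      (n + 1) * ‖h‖ ^ 2 * polyExp W hH₁ (MvPolynomial.X h ^ n) := by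
  have hm : AEMeasurable (W h : Lp ℝ 2 P) P := (Lp.aestronglyMeasurable _).aemeasurable
  have key : ∀ k : ℕ, polyExp W hH₁ (MvPolynomial.X h ^ k) =
      ∫ x, x ^ k ∂gaussianReal 0 (‖h‖₊ ^ 2) := fun k => by
    rw [← map_W W hH₁ h, integral_map hm (by fun_prop), polyExp_apply]
    simp
  rw [key, key, integral_pow_add_two_gaussianReal]
  simp

theorem polyExp_X (h : H) : polyExp W hH₁ (MvPolynomial.X h) = 0 := by
  have hm : AEMeasurable (W h : Lp ℝ 2 P) P := (Lp.aestronglyMeasurable _).aemeasurable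
  have h1 : ∫ x, x ∂P.map (W h : Lp ℝ 2 P) = ∫ ω, (W h : Lp ℝ 2 P) ω ∂P :=
    integral_map hm (by fun_prop)
  rw [map_W W hH₁, integral_id_gaussianReal] at h1
  simpa [polyExp_apply] using h1.symm

omit hH₁ [IsProbabilityMeasure P] in
theorem polyVar_X_add_smul_X (k h : H) (t : ℝ) :
    polyVar W (MvPolynomial.X k + t • MvPolynomial.X h) =ᵐ[P]
      polyVar W (MvPolynomial.X (k + t • h)) := by
  have h1 : (W (k + t • h) : Lp ℝ 2 P) = (W k : Lp ℝ 2 P) + t • (W h : Lp ℝ 2 P) := by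
    simp
  filter_upwards [Lp.coeFn_add (W k : Lp ℝ 2 P) (t • (W h : Lp ℝ 2 P)),
    Lp.coeFn_smul t (W h : Lp ℝ 2 P)] with ω h2 h3
  rw [polyVar_X, h1, h2, Pi.add_apply, h3]
  simp

theorem polyExp_X_add_smul_X_pow (k h : H) (t : ℝ) (n : ℕ) :
    polyExp W hH₁ ((MvPolynomial.X k + t • MvPolynomial.X h) ^ n) =
      polyExp W hH₁ (MvPolynomial.X (k + t • h) ^ n) := by
  refine polyExp_congr W hH₁ ?_
  filter_upwards [polyVar_X_add_smul_X W k h t] with ω h1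
  rw [polyVar_pow, polyVar_pow, h1]

/-- Gaussian integration by parts for the powers of one variable. -/
theorem polyExp_X_pow_mul_X (k h : H) (n : ℕ) :
    polyExp W hH₁ (MvPolynomial.X k ^ (n + 1) * MvPolynomial.X h) =
      (n + 1) * inner ℝ k h * polyExp W hH₁ (MvPolynomial.X k ^ n) := by
  set φ := polyExp W hH₁
  have hd : ∀ m : ℕ, HasDerivAt (fun t : ℝ => φ (MvPolynomial.X (k + t • h) ^ (m + 1)))
      ((m + 1) * φ (MvPolynomial.X k ^ m * MvPolynomial.X h)) 0 := fun m => by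
    have h1 := hasDerivAt_linearMap_pow_mul φ (MvPolynomial.X k) (MvPolynomial.X h) m 1 0
    simpa [φ, polyExp_X_add_smul_X_pow] using h1
  have hn : HasDerivAt (fun t : ℝ => ‖k + t • h‖ ^ 2) (2 * inner ℝ k h) 0 := by
    have h1 : HasDerivAt (fun t : ℝ => k + t • h) h 0 := by
      simpa using ((hasDerivAt_id (0 : ℝ)).smul_const h).const_add k
    simpa using h1.norm_sq
  -- Differentiates `E[W(k+th)^(m+2)] = (m+1) ‖k+th‖² E[W(k+th)^m]` at `t = 0`. The derivative `d`
  -- of the lower moment comes from `hd`, hence the two-step induction.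
  have step : ∀ (m : ℕ) (d : ℝ),
      HasDerivAt (fun t : ℝ => φ (MvPolynomial.X (k + t • h) ^ m)) d 0 →
      (m + 2) * φ (MvPolynomial.X k ^ (m + 1) * MvPolynomial.X h) = (m + 1) *
        (2 * inner ℝ k h * φ (MvPolynomial.X k ^ m) + ‖k‖ ^ 2 * d) := fun m d hm => by
    have h1 := hd (m + 1)
    have h2 : (fun t : ℝ => φ (MvPolynomial.X (k + t • h) ^ (m + 1 + 1))) = fun t =>
        (m + 1) * (‖k + t • h‖ ^ 2 * φ (MvPolynomial.X (k + t • h) ^ m)) := by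
      funext t
      rw [← mul_assoc]
      exact polyExp_X_pow_add_two W hH₁ _ _
    rw [h2] at h1
    have h3 := h1.unique ((hn.mul hm).const_mul ((m : ℝ) + 1))
    simp only [zero_smul, add_zero] at h3
    push_cast at h3
    linear_combination h3
  induction n using Nat.twoStepInduction with
  | zero =>
    have h1 := step 0 0 (by simpa using hasDerivAt_const (0 : ℝ) _)
    push_cast at h1
    push_cast
    linear_combination h1 / 2
  | one =>
    have h1 := step 1 _ (hd 0)
    have h2 : φ (MvPolynomial.X k) = 0 := polyExp_X W hH₁ k
    have h3 : φ (MvPolynomial.X h) = 0 := polyExp_X W hH₁ h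
    rw [pow_zero, one_mul, pow_one, h2, h3] at h1
    rw [pow_one, h2]
    push_cast at h1
    linear_combination h1 / 3
  | more n ih _ =>
    have h1 := step (n + 2) _ (hd (n + 1))
    have h2 : φ (MvPolynomial.X k ^ (n + 2)) = _ := polyExp_X_pow_add_two W hH₁ k n
    have h3 : ((n : ℝ) + 4) ≠ 0 := by positivity
    refine mul_left_cancel₀ h3 ?_
    rw [ih] at h1
    push_cast at h1 ⊢
    linear_combination h1 + (n + 3) * inner ℝ k h * (-(n : ℝ) - 2) * h2

omit hH₁ [IsProbabilityMeasure P]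

/-- The formal derivative in the direction `h`, with `W(k)` having derivative `⟨k, h⟩`. -/
def dirDeriv (h : H) : Derivation ℝ (MvPolynomial H ℝ) (MvPolynomial H ℝ) :=
  MvPolynomial.mkDerivation ℝ fun k => MvPolynomial.C (inner ℝ k h)

theorem dirDeriv_X (h k : H) : dirDeriv h (MvPolynomial.X k) = MvPolynomial.C (inner ℝ k h) :=
  MvPolynomial.mkDerivation_X _ _ _

/-- A linear form in the variables can be replaced by the single variable `X k`, since `W` is linear
up to null sets; this reduces polarization to powers of one Gaussian. -/
theorem exists_of_mem_span_X {x : MvPolynomial H ℝ}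
    (hx : x ∈ Submodule.span ℝ (Set.range (MvPolynomial.X : H → MvPolynomial H ℝ))) :
    ∃ k : H, polyVar W x =ᵐ[P] polyVar W (MvPolynomial.X k) ∧
      ∀ h, dirDeriv h x = MvPolynomial.C (inner ℝ k h) := by
  induction hx using Submodule.span_induction with
  | mem x hx =>
    obtain ⟨k, rfl⟩ := hx
    exact ⟨k, Filter.EventuallyEq.rfl, fun h => dirDeriv_X h k⟩
  | zero =>
    refine ⟨0, ?_, fun h => by simp⟩
    filter_upwards [Lp.coeFn_zero ℝ 2 P] with ω h1
    simp [polyVar] at h1 ⊢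
    simp [h1]
  | add x y _ _ hx hy =>
    obtain ⟨k, hk, hk'⟩ := hx
    obtain ⟨l, hl, hl'⟩ := hy
    refine ⟨k + l, ?_, fun h => by rw [map_add, hk', hl', inner_add_left, map_add]⟩
    have h0 := polyVar_X_add_smul_X W k l 1
    rw [one_smul, one_smul] at h0
    filter_upwards [h0, hk, hl] with ω h1 h2 h3
    rw [← h1, polyVar_add, polyVar_add, h2, h3]
  | smul c x _ hx =>
    obtain ⟨k, hk, hk'⟩ := hx
    refine ⟨c • k, ?_, fun h => by
      rw [Derivation.map_smul, hk', real_inner_smul_left, MvPolynomial.smul_eq_C_mul, ← map_mul]⟩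
    filter_upwards [hk, Lp.coeFn_smul c (W k : Lp ℝ 2 P)] with ω h1 h2
    rw [polyVar_smul, h1, polyVar_X, polyVar_X, map_smul]
    exact h2.symm

variable [IsProbabilityMeasure P]

/-- Gaussian integration by parts. -/
theorem polyExp_mul_X (hH₁ : IsGaussianHilbertSpace H₁) (p : MvPolynomial H ℝ) (h : H) :
    polyExp W hH₁ (p * MvPolynomial.X h) = polyExp W hH₁ (dirDeriv h p) := by
  rw [← sub_eq_zero]
  refine linearMap_mvPolynomial_eq_zero
    ((polyExp W hH₁) ∘ₗ (LinearMap.mulRight ℝ (MvPolynomial.X h)) -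
      (polyExp W hH₁) ∘ₗ (dirDeriv h).toLinearMap) (fun x hx n => ?_) p
  obtain ⟨k, hk, hk'⟩ := exists_of_mem_span_X W hx
  have hpow : ∀ (m : ℕ) (q : MvPolynomial H ℝ),
      polyExp W hH₁ (x ^ m * q) = polyExp W hH₁ (MvPolynomial.X k ^ m * q) := fun m q => by
    refine polyExp_congr W hH₁ ?_
    filter_upwards [hk] with ω h1
    simp only [polyVar_mul, polyVar_pow, h1]
  change polyExp W hH₁ (x ^ n * MvPolynomial.X h) - polyExp W hH₁ (dirDeriv h (x ^ n)) = 0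
  rw [sub_eq_zero, hpow]
  cases n with
  | zero => simp [polyExp_X]
  | succ n =>
    rw [polyExp_X_pow_mul_X, Derivation.leibniz_pow, hk', smul_eq_mul, mul_comm (x ^ _),
      ← MvPolynomial.smul_eq_C_mul, map_nsmul, map_smul, Nat.add_sub_cancel]
    have := hpow n 1
    rw [mul_one, mul_one] at this
    rw [this]
    simp
    ring

end PolynomialVariables

/-! ### The relation `A* A` in Hilbert spaces. -/

section AdjointComposition

variable {E F : Type*} [NormedAddCommGroup E] [InnerProductSpace ℝ E]
  [NormedAddCommGroup F] [InnerProductSpace ℝ F]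

/-- The relation `A* A` for a linear relation `A`. -/
def adjointComp (g : Submodule ℝ (E × F)) : Submodule ℝ (E × E) where
  carrier := {x | ∃ u, (x.1, u) ∈ g ∧ (u, x.2) ∈ g.adjoint}
  zero_mem' := ⟨0, g.zero_mem, g.adjoint.zero_mem⟩
  add_mem' := by
    rintro x y ⟨u, hu, hu'⟩ ⟨v, hv, hv'⟩
    exact ⟨u + v, g.add_mem hu hv, g.adjoint.add_mem hu' hv'⟩
  smul_mem' := by
    rintro c x ⟨u, hu, hu'⟩
    exact ⟨c • u, g.smul_mem c hu, g.adjoint.smul_mem c hu'⟩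

theorem inner_eq_of_mem_adjoint {g : Submodule ℝ (E × F)} {x : E × F} {y : F × E} (hx : x ∈ g)
    (hy : y ∈ g.adjoint) : inner ℝ x.2 y.1 = inner ℝ x.1 y.2 :=
  sub_eq_zero.1 ((Submodule.mem_adjoint_iff g y).1 hy x.1 x.2 hx)

theorem adjointComp_symmetric (g : Submodule ℝ (E × F)) {x y : E × E} (hx : x ∈ adjointComp g)
    (hy : y ∈ adjointComp g) : inner ℝ x.2 y.1 = inner ℝ x.1 y.2 := by
  obtain ⟨u, hu, hu'⟩ := hx
  obtain ⟨v, hv, hv'⟩ := hy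
  have h1 := inner_eq_of_mem_adjoint hu hv'
  have h2 := inner_eq_of_mem_adjoint hv hu'
  simp only at h1 h2
  rw [← h1, real_inner_comm, ← h2, real_inner_comm]

theorem isClosed_adjoint (g : Submodule ℝ (E × F)) :
    IsClosed (g.adjoint : Set (F × E)) := by
  have h : (g.adjoint : Set (F × E)) =
      ⋂ x ∈ g, {y : F × E | inner ℝ x.2 y.1 - inner ℝ x.1 y.2 = 0} := by
    ext y
    simp only [SetLike.mem_coe, Submodule.mem_adjoint_iff, Set.mem_iInter, Prod.forall]
    rfl
  rw [h]
  exact isClosed_biInter fun x _ => isClosed_eq (by fun_prop) continuous_const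

theorem adjoint_topologicalClosure (g : Submodule ℝ (E × F)) :
    g.topologicalClosure.adjoint = g.adjoint := by
  refine le_antisymm (fun y hy => ?_) fun y hy => ?_
  · rw [Submodule.mem_adjoint_iff] at hy ⊢
    exact fun a b hab => hy a b (g.le_topologicalClosure hab)
  · rw [Submodule.mem_adjoint_iff]
    intro a b hab
    have hcl : IsClosed {x : E × F | inner ℝ x.2 y.1 - inner ℝ x.1 y.2 = 0} :=
      isClosed_eq (by fun_prop) continuous_const
    exact closure_minimal (fun x hx => sub_eq_zero.2 (inner_eq_of_mem_adjoint hx hy)) hcl hab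

/-- The relation is the image of the closed space of triples `(x, u, y)` under forgetting `u`. Since
`‖u‖² = ⟨x, y⟩`, that map is bounded below, so its range is closed. -/
theorem isClosed_adjointComp [CompleteSpace E] [CompleteSpace F] {g : Submodule ℝ (E × F)}
    (hg : IsClosed (g : Set (E × F))) : IsClosed (adjointComp g : Set (E × E)) := by
  let T : Submodule ℝ (E × F × E) :=
    g.comap ((LinearMap.fst ℝ E (F × E)).prod
      ((LinearMap.fst ℝ F E) ∘ₗ (LinearMap.snd ℝ E (F × E)))) ⊓
    g.adjoint.comap (LinearMap.snd ℝ E (F × E))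
  have hT : IsClosed (T : Set (E × F × E)) :=
    (hg.preimage (f := fun z : E × F × E => (z.1, z.2.1)) (by fun_prop)).inter
      ((isClosed_adjoint g).preimage (f := fun z : E × F × E => z.2) (by fun_prop))
  have : CompleteSpace T := hT.completeSpace_coe
  let f : T →L[ℝ] E × E := ((ContinuousLinearMap.fst ℝ E (F × E)).prod
      ((ContinuousLinearMap.snd ℝ F E) ∘L (ContinuousLinearMap.snd ℝ E (F × E)))) ∘L T.subtypeL
  have hrange : (adjointComp g : Set (E × E)) = Set.range f := by
    ext x
    constructor
    · rintro ⟨u, hu, hu'⟩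
      exact ⟨⟨(x.1, u, x.2), hu, hu'⟩, rfl⟩
    · rintro ⟨z, rfl⟩
      exact ⟨z.1.2.1, z.2.1, z.2.2⟩
  have hanti : AntilipschitzWith 1 f := by
    refine AddMonoidHomClass.antilipschitz_of_bound f fun z => ?_
    obtain ⟨⟨x, u, y⟩, h1, h2⟩ := z
    have h3 : inner ℝ u u = inner ℝ x y := inner_eq_of_mem_adjoint h1 h2
    rw [real_inner_self_eq_norm_sq] at h3
    have h4 := real_inner_le_norm x y
    have h5 : ‖u‖ ≤ max ‖x‖ ‖y‖ := by
      refine abs_le_of_sq_le_sq' ?_ (le_max_of_le_left (norm_nonneg x)) |>.2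
      rw [h3, pow_two]
      exact h4.trans (mul_le_mul (le_max_left _ _) (le_max_right _ _) (norm_nonneg _)
        (le_max_of_le_left (norm_nonneg x)))
    change max ‖x‖ (max ‖u‖ ‖y‖) ≤ (1 : ℝ≥0) * max ‖x‖ ‖y‖
    rw [NNReal.coe_one, one_mul]
    exact max_le (le_max_left _ _) (max_le h5 (le_max_right _ _))
  rw [hrange]
  exact hanti.isClosed_range f.uniformContinuous

end AdjointComposition

/-! ### The number operator on polynomials. -/

section NumberOperator

theorem totalDegree_pderiv_le {σ : Type*} (i : σ) (p : MvPolynomial σ ℝ) :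
    (MvPolynomial.pderiv i p).totalDegree ≤ p.totalDegree - 1 := by
  refine Finset.sup_le fun m hm => ?_
  rw [MvPolynomial.mem_support_iff, MvPolynomial.coeff_pderiv] at hm
  have h := MvPolynomial.le_totalDegree (MvPolynomial.mem_support_iff.2 (left_ne_zero_of_mul hm))
  rw [Finsupp.sum_add_index' (by simp) (by simp), Finsupp.sum_single_index rfl] at h
  exact Nat.le_sub_of_add_le h

/-- By Euler's identity the component of degree `i` is multiplied by `i - (n + 1)`, which kills the
top degree. -/
theorem totalDegree_euler_sub_le {m n : ℕ} {p : MvPolynomial (Fin m) ℝ}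
    (hp : p.totalDegree ≤ n + 1) :
    (∑ j, MvPolynomial.X j * MvPolynomial.pderiv j p -
      ((n + 1 : ℕ) : ℝ) • p).totalDegree ≤ n := by
  have h1 : ∑ j, MvPolynomial.X j * MvPolynomial.pderiv j p - ((n + 1 : ℕ) : ℝ) • p =
      ∑ i ∈ Finset.range (p.totalDegree + 1),
        ((i : ℝ) - (n + 1 : ℕ)) • MvPolynomial.homogeneousComponent i p := by
    conv_lhs => rw [← MvPolynomial.sum_homogeneousComponent p]
    simp only [map_sum, Finset.mul_sum, sub_smul, Finset.sum_sub_distrib, Finset.smul_sum]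
    rw [Finset.sum_comm]
    congr 1
    refine Finset.sum_congr rfl fun i _ => ?_
    rw [(MvPolynomial.homogeneousComponent_isHomogeneous i p).sum_X_mul_pderiv, Nat.cast_smul_eq_nsmul]
  rw [h1]
  refine MvPolynomial.totalDegree_finsetSum_le fun i hi => ?_
  rcases eq_or_ne i (n + 1) with rfl | hne
  · simp
  · refine (MvPolynomial.totalDegree_smul_le _ _).trans
      ((MvPolynomial.homogeneousComponent_isHomogeneous i p).totalDegree_le.trans ?_)
    have := Finset.mem_range.1 hi
    omega

variable {H : Type*} [NormedAddCommGroup H] [InnerProductSpace ℝ H]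

/-- The operator `δ D` on polynomials in `W(k₁), …, W(kₘ)`. -/
def numberOp {m : ℕ} (k : Fin m → H) (p : MvPolynomial (Fin m) ℝ) : MvPolynomial (Fin m) ℝ :=
  ∑ j, MvPolynomial.X j * MvPolynomial.pderiv j p -
    ∑ j, ∑ i, (inner ℝ (k i) (k j) : ℝ) • MvPolynomial.pderiv i (MvPolynomial.pderiv j p)

theorem totalDegree_numberOp_sub_le {m n : ℕ} (k : Fin m → H) {p : MvPolynomial (Fin m) ℝ}
    (hp : p.totalDegree ≤ n + 1) :
    (numberOp k p - ((n + 1 : ℕ) : ℝ) • p).totalDegree ≤ n := by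
  rw [numberOp, sub_right_comm]
  refine (MvPolynomial.totalDegree_sub _ _).trans (max_le (totalDegree_euler_sub_le hp) ?_)
  refine MvPolynomial.totalDegree_finsetSum_le fun j _ =>
    MvPolynomial.totalDegree_finsetSum_le fun i _ =>
      (MvPolynomial.totalDegree_smul_le _ _).trans ?_
  have h1 := totalDegree_pderiv_le i (MvPolynomial.pderiv j p)
  have h2 := totalDegree_pderiv_le j p
  omega

theorem numberOp_of_totalDegree_eq_zero {m : ℕ} (k : Fin m → H) {p : MvPolynomial (Fin m) ℝ}
    (hp : p.totalDegree = 0) : numberOp k p = 0 := by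
  rw [MvPolynomial.totalDegree_eq_zero_iff_eq_C.1 hp]
  simp [numberOp]

theorem dirDeriv_rename {m : ℕ} (k : Fin m → H) (h : H) (p : MvPolynomial (Fin m) ℝ) :
    dirDeriv h (MvPolynomial.rename k p) =
      ∑ j, (inner ℝ (k j) h : ℝ) • MvPolynomial.rename k (MvPolynomial.pderiv j p) := by
  induction p using MvPolynomial.induction_on with
  | C a => simp
  | add p q hp hq => simp [hp, hq, Finset.sum_add_distrib]
  | mul_X p i hp =>
    rw [map_mul, Derivation.leibniz, hp, MvPolynomial.rename_X, dirDeriv_X]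
    have h1 : ∀ j, (inner ℝ (k j) h : ℝ) •
        MvPolynomial.rename k (MvPolynomial.pderiv j (p * MvPolynomial.X i)) =
        (if j = i then (inner ℝ (k j) h : ℝ) • MvPolynomial.rename k p else 0) +
          MvPolynomial.X (k i) * ((inner ℝ (k j) h : ℝ) •
            MvPolynomial.rename k (MvPolynomial.pderiv j p)) := fun j => by
      rw [Derivation.leibniz, MvPolynomial.pderiv_X, map_add, smul_add]
      congr 1
      · split_ifs with hj
        · simp [hj]
        · simp [Pi.single_eq_of_ne (Ne.symm hj)]
      · rw [smul_eq_mul, map_mul, MvPolynomial.rename_X, mul_smul_comm]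
    rw [Finset.sum_congr rfl fun j _ => h1 j, Finset.sum_add_distrib, Finset.sum_ite_eq',
      if_pos (Finset.mem_univ i), ← Finset.mul_sum, smul_eq_mul, smul_eq_mul, mul_comm,
      MvPolynomial.smul_eq_C_mul]

/-- Displays the operator as the divergence of `∑ ∂ⱼp kⱼ`, each summand having the form produced by
integration by parts. -/
theorem rename_numberOp {m : ℕ} (k : Fin m → H) (p : MvPolynomial (Fin m) ℝ) :
    MvPolynomial.rename k (numberOp k p) =
      ∑ j, (MvPolynomial.rename k (MvPolynomial.pderiv j p) * MvPolynomial.X (k j) -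
        dirDeriv (k j) (MvPolynomial.rename k (MvPolynomial.pderiv j p))) := by
  simp only [numberOp, map_sub, map_sum, map_mul, map_smul, MvPolynomial.rename_X, dirDeriv_rename,
    mul_comm (MvPolynomial.X _), Finset.sum_sub_distrib]

variable {Ω : Type*} [MeasurableSpace Ω] {P : Measure Ω} [IsProbabilityMeasure P]
variable {H₁ : Submodule ℝ (Lp ℝ 2 P)} (hH₁ : IsGaussianHilbertSpace H₁) (W : H ≃ₗᵢ[ℝ] H₁)
include hH₁

theorem polyExp_mul_dirDeriv (p q : MvPolynomial H ℝ) (h : H) :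
    polyExp W hH₁ (p * dirDeriv h q) =
      polyExp W hH₁ ((p * MvPolynomial.X h - dirDeriv h p) * q) := by
  have h1 := polyExp_mul_X W hH₁ (p * q) h
  rw [Derivation.leibniz, map_add, smul_eq_mul, smul_eq_mul] at h1
  rw [sub_mul, map_sub, mul_right_comm, h1, mul_comm q]
  ring

end NumberOperator

/-! ### Totality of polynomials. -/

section Density

variable {Ω : Type*} [mΩ : MeasurableSpace Ω] {P : Measure Ω}

/-- A square integrable random variable is determined by its characteristic functionals against
the random variables generating the `σ`-field. -/
theorem ae_eq_zero_of_integral_cexp {S : Set (Ω → ℝ)} (hS : ∀ X ∈ S, Measurable X)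
    (hσ : mΩ ≤ ⨆ X ∈ S, MeasurableSpace.comap X (borel ℝ)) {f : Ω → ℝ} (hf : Measurable f)
    (hfi : Integrable f P)
    (h : ∀ (J : Finset S) (c : J → ℝ),
      ∫ ω, (f ω : ℂ) * Complex.exp ((∑ j, c j * (j : S).1 ω : ℝ) * Complex.I) ∂P = 0) :
    f =ᵐ[P] 0 := by
  classical
  -- The positive and negative parts of `f` become finite measures; the hypothesis equates the
  -- characteristic functions of their finite-dimensional marginals.
  set μ := P.withDensity fun ω => ENNReal.ofReal (f ω) with hμ
  set ν := P.withDensity fun ω => ENNReal.ofReal (-f ω) with hν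
  have : IsFiniteMeasure μ := isFiniteMeasure_withDensity_ofReal hfi.2
  have : IsFiniteMeasure ν := isFiniteMeasure_withDensity_ofReal hfi.neg.2
  let Φ : Ω → S → ℝ := fun ω X => X.1 ω
  have hΦ : Measurable Φ := measurable_pi_lambda _ fun X => hS X.1 X.2
  have hmap : μ.map Φ = ν.map Φ := by
    refine IsProjectiveLimit.unique (P := fun J : Finset S => (ν.map Φ).map J.restrict)
      (fun J => ?_) fun J => rfl
    have hr : Measurable (J.restrict : (S → ℝ) → J → ℝ) := Finset.measurable_restrict J
    change (μ.map Φ).map J.restrict = (ν.map Φ).map J.restrict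
    rw [Measure.map_map hr hΦ, Measure.map_map hr hΦ]
    refine Measure.ext_of_charFunDual ?_
    funext l
    have hl : ∀ ω, l ((J.restrict ∘ Φ) ω) = ∑ j, l (Pi.single j 1) * (j : S).1 ω := fun ω => by
      conv_lhs => rw [← Finset.univ_sum_single ((J.restrict ∘ Φ) ω), map_sum]
      refine Finset.sum_congr rfl fun j _ => ?_
      have h1 : (Pi.single j ((J.restrict ∘ Φ) ω j) : J → ℝ) =
          ((j : S).1 ω) • (Pi.single j 1 : J → ℝ) := by
        rw [← Pi.single_smul, smul_eq_mul, mul_one]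
        rfl
      rw [h1, map_smul, smul_eq_mul, mul_comm]
    have hmeas : Measurable fun ω =>
        Complex.exp ((∑ j : J, l (Pi.single j 1) * (j : S).1 ω : ℝ) * Complex.I) := by
      have := fun j : J => hS _ (j : S).2
      fun_prop
    have hsplit : ∀ g : Ω → ℝ, Measurable g →
        charFunDual ((P.withDensity fun ω => ENNReal.ofReal (g ω)).map (J.restrict ∘ Φ)) l =
          ∫ ω, (max (g ω) 0 : ℝ) •
            Complex.exp ((∑ j : J, l (Pi.single j 1) * (j : S).1 ω : ℝ) * Complex.I) ∂P := by
      intro g hg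
      rw [charFunDual_apply, integral_map (hr.comp hΦ).aemeasurable (by fun_prop),
        integral_withDensity_eq_integral_toReal_smul hg.ennreal_ofReal
          (Filter.Eventually.of_forall fun _ => ENNReal.ofReal_lt_top)]
      refine integral_congr_ae (Filter.Eventually.of_forall fun ω => ?_)
      simp only [hl, ENNReal.toReal_ofReal']
    have hint : ∀ g : Ω → ℝ, Integrable g P → Integrable (fun ω => (max (g ω) 0 : ℝ) •
        Complex.exp ((∑ j : J, l (Pi.single j 1) * (j : S).1 ω : ℝ) * Complex.I)) P := by
      intro g hg
      refine hg.pos_part.smul_bdd (C := 1) hmeas.aestronglyMeasurable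
        (Filter.Eventually.of_forall fun ω => ?_)
      rw [Complex.norm_exp_ofReal_mul_I]
    rw [hμ, hν, hsplit f hf, hsplit (fun ω => -f ω) hf.neg, ← sub_eq_zero,
      ← integral_sub (hint f hfi) (hint (fun ω => -f ω) hfi.neg), ← h J fun j => l (Pi.single j 1)]
    refine integral_congr_ae (Filter.Eventually.of_forall fun ω => ?_)
    simp only [← sub_smul]
    rw [Complex.real_smul]
    congr 2
    rcases le_total (f ω) 0 with h0 | h0
    · rw [max_eq_right h0, max_eq_left (by linarith)]; ring
    · rw [max_eq_left h0, max_eq_right (by linarith)]; ring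
  have hμν : μ = ν := by
    ext A hA
    -- Every event is a preimage under `Φ`, so equality of the image measures suffices.
    have h1 : mΩ ≤ MeasurableSpace.comap Φ MeasurableSpace.pi := by
      refine hσ.trans (iSup₂_le fun X hX => ?_)
      rw [MeasurableSpace.pi, MeasurableSpace.comap_iSup]
      refine le_trans ?_ (le_iSup _ (⟨X, hX⟩ : S))
      rw [MeasurableSpace.comap_comp]
      exact le_rfl
    obtain ⟨B, hB, rfl⟩ := h1 A hA
    rw [← Measure.map_apply hΦ hB, ← Measure.map_apply hΦ hB, hmap]
  have h2 := (withDensity_eq_iff hf.ennreal_ofReal.aemeasurable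
    hf.neg.ennreal_ofReal.aemeasurable (by
      rw [← lt_top_iff_ne_top]
      exact hfi.lintegral_lt_top)).1 hμν
  filter_upwards [h2] with ω h3
  rcases le_total (f ω) 0 with h0 | h0
  · rw [ENNReal.ofReal_of_nonpos h0, eq_comm, Pi.neg_apply, ENNReal.ofReal_eq_zero] at h3
    exact le_antisymm h0 (neg_nonpos.1 h3)
  · rw [Pi.neg_apply, ENNReal.ofReal_of_nonpos (p := -f ω) (by linarith),
      ENNReal.ofReal_eq_zero] at h3
    exact le_antisymm h3 h0

variable [IsProbabilityMeasure P]
variable {H₁ : Submodule ℝ (Lp ℝ 2 P)} (hH₁ : IsGaussianHilbertSpace H₁)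
variable {H : Type*} [NormedAddCommGroup H] [InnerProductSpace ℝ H] (W : H ≃ₗᵢ[ℝ] H₁)
include hH₁

theorem exists_mem_polySpace (p : MvPolynomial H ℝ) :
    ∃ n, (memLp_polyVar W hH₁ p (q := 2) (by simp)).toLp ∈ polySpace H₁ n := by
  obtain ⟨m, k, -, q, hq⟩ := MvPolynomial.exists_fin_rename p
  refine ⟨q.totalDegree, m, q, fun i => W (k i), le_rfl, ?_⟩
  filter_upwards [MemLp.coeFn_toLp (memLp_polyVar W hH₁ p (q := 2) (by simp))] with ω h1
  rw [h1, hq, polyVar_rename]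

omit [IsProbabilityMeasure P] in
theorem memLp_exp_abs_W (h : H) : MemLp (fun ω => Real.exp |(W h : Lp ℝ 2 P) ω|) 2 P := by
  have hm : AEMeasurable (W h : Lp ℝ 2 P) P := (Lp.aestronglyMeasurable _).aemeasurable
  have hexp : ∀ t : ℝ, Integrable (fun ω => Real.exp (t * (W h : Lp ℝ 2 P) ω)) P := fun t => by
    have h1 := integrable_exp_mul_gaussianReal (μ := 0) (v := ‖h‖₊ ^ 2) t
    rw [← map_W W hH₁ h] at h1
    exact h1.comp_aemeasurable hm
  rw [memLp_two_iff_integrable_sq (by fun_prop)]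
  refine (integrable_exp_mul_abs (hexp 2) (hexp (-2))).congr
    (Filter.Eventually.of_forall fun ω => ?_)
  simp only
  rw [← Real.exp_nat_mul]
  norm_num

-- Expands the exponential in powers of `W h`. Each term integrates to zero, and `|F| exp |W h|`
-- dominates, being a product of two square integrable functions.
omit [IsProbabilityMeasure P] in
theorem integral_mul_cexp_W {F : Lp ℝ 2 P}
    (hF : ∀ p : MvPolynomial H ℝ, ∫ ω, F ω * polyVar W p ω ∂P = 0) (h : H) :
    ∫ ω, (F ω : ℂ) * Complex.exp (((W h : Lp ℝ 2 P) ω : ℝ) * Complex.I) ∂P = 0 := by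
  set X : Ω → ℝ := ⇑(W h : Lp ℝ 2 P) with hX
  have hXm : AEStronglyMeasurable X P := Lp.aestronglyMeasurable _
  have hFm : AEStronglyMeasurable (F : Ω → ℝ) P := Lp.aestronglyMeasurable _
  have hexpR : ∀ x : ℝ, HasSum (fun n : ℕ => x ^ n / n.factorial) (Real.exp x) := fun x => by
    rw [Real.exp_eq_exp_ℝ]
    exact NormedSpace.expSeries_div_hasSum_exp x
  have hexpC : ∀ x : ℂ, HasSum (fun n : ℕ => x ^ n / n.factorial) (Complex.exp x) := fun x => by
    rw [Complex.exp_eq_exp_ℂ]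
    exact NormedSpace.expSeries_div_hasSum_exp x
  have hsum : ∀ ω, HasSum (fun n : ℕ => |F ω| * (|X ω| ^ n / n.factorial))
      (|F ω| * Real.exp |X ω|) := fun ω => by
    exact (hexpR (|X ω|)).mul_left _
  have key := hasSum_integral_of_dominated_convergence
    (F := fun (n : ℕ) ω => (F ω : ℂ) * (((X ω : ℂ) * Complex.I) ^ n / n.factorial))
    (f := fun ω => (F ω : ℂ) * Complex.exp ((X ω : ℂ) * Complex.I)) (μ := P)
    (fun (n : ℕ) ω => |F ω| * (|X ω| ^ n / n.factorial)) (fun n => by fun_prop)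
    (fun n => Filter.Eventually.of_forall fun ω => by simp)
    (Filter.Eventually.of_forall fun ω => (hsum ω).summable)
    (by
      simp only [fun ω => (hsum ω).tsum_eq]
      exact (Lp.memLp F).norm.integrable_mul (memLp_exp_abs_W hH₁ W h))
    (Filter.Eventually.of_forall fun ω => (hexpC ((X ω : ℂ) * Complex.I)).mul_left (F ω : ℂ))
  refine key.unique ?_
  convert hasSum_zero using 2 with n
  have h1 : ∀ ω, (F ω : ℂ) * (((X ω : ℂ) * Complex.I) ^ n / n.factorial) =
      (Complex.I ^ n / n.factorial) * ((F ω * polyVar W (MvPolynomial.X h ^ n) ω : ℝ) : ℂ) :=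
    fun ω => by
      simp only [polyVar_pow, polyVar_X]
      push_cast
      ring
  simp only [h1]
  rw [integral_const_mul, integral_complex_ofReal, hF]
  simp

/-- Polynomial random variables are total in `L²(Ω)`. -/
theorem eq_zero_of_forall_inner_polySpace (hσ : mΩ = sigmaField H₁) {F : Lp ℝ 2 P}
    (hF : ∀ n, ∀ p ∈ polySpace H₁ n, inner ℝ p F = 0) : F = 0 := by
  -- `H₁` serves as its own parameter space.
  let W := LinearIsometryEquiv.refl ℝ H₁
  have hF' : ∀ p : MvPolynomial H₁ ℝ, ∫ ω, F ω * polyVar W p ω ∂P = 0 := fun p => by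
    obtain ⟨n, hn⟩ := exists_mem_polySpace hH₁ W p
    have h1 := hF n _ hn
    rw [L2.inner_def] at h1
    rw [← h1]
    refine integral_congr_ae ?_
    filter_upwards [MemLp.coeFn_toLp (memLp_polyVar W hH₁ p (q := 2) (by simp))] with ω h2
    rw [h2]
    rfl
  have hFi : Integrable (F : Ω → ℝ) P := (Lp.memLp F).integrable (by norm_num)
  refine Lp.ext ((ae_eq_zero_of_integral_cexp (fun X hX => hX.1) hσ.le
    (Lp.stronglyMeasurable F).measurable hFi fun J c => ?_).trans (Lp.coeFn_zero ℝ 2 P).symm)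
  have hrep : ∀ X : {X : Ω → ℝ | Measurable X ∧ ∃ ξ ∈ H₁, X =ᵐ[P] (ξ : Ω → ℝ)},
      ∃ h : H₁, X.1 =ᵐ[P] (W h : Lp ℝ 2 P) := fun X => by
    obtain ⟨ξ, hξ, hX⟩ := X.2.2
    exact ⟨W.symm ⟨ξ, hξ⟩, by simpa using hX⟩
  choose k hk using hrep
  rw [← integral_mul_cexp_W hH₁ W hF' (∑ j : J, c j • k j)]
  refine integral_congr_ae ?_
  have h1 : ((W (∑ j : J, c j • k j) : Lp ℝ 2 P) : Ω → ℝ) =ᵐ[P]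
      fun ω => ∑ j : J, c j * (W (k j) : Lp ℝ 2 P) ω := by
    have h2 : (W (∑ j : J, c j • k j) : Lp ℝ 2 P) = ∑ j : J, c j • (W (k j) : Lp ℝ 2 P) := by
      simp
    rw [h2]
    filter_upwards [Lp.coeFn_finsetSum Finset.univ fun j : J => c j • (W (k j) : Lp ℝ 2 P),
      ae_all_iff.2 fun j : J => Lp.coeFn_smul (c j) (W (k j) : Lp ℝ 2 P)] with ω h3 h4
    rw [h3, Finset.sum_apply]
    exact Finset.sum_congr rfl fun j _ => h4 j
  filter_upwards [h1, ae_all_iff.2 fun j : J => hk j] with ω h2 h3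
  rw [h2]
  simp only [h3]

end Density

/-! ### Divergence, closability and the identification of `D* D`. -/

section Divergence

variable {Ω : Type*} [mΩ : MeasurableSpace Ω] {P : Measure Ω} [IsProbabilityMeasure P]
variable {H₁ : Submodule ℝ (Lp ℝ 2 P)} (hH₁ : IsGaussianHilbertSpace H₁)
variable {H : Type*} [NormedAddCommGroup H] [InnerProductSpace ℝ H] (W : H ≃ₗᵢ[ℝ] H₁)

/-- The class in `L²(Ω)` of a polynomial random variable. -/
def polyLp (p : MvPolynomial H ℝ) : Lp ℝ 2 P :=
  (memLp_polyVar W hH₁ p (q := 2) (by simp)).toLp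

theorem coeFn_polyLp (p : MvPolynomial H ℝ) : polyLp hH₁ W p =ᵐ[P] polyVar W p :=
  MemLp.coeFn_toLp _

theorem memLp_polyVar_smul (p : MvPolynomial H ℝ) (h : H) (hH₁ : IsGaussianHilbertSpace H₁) :
    MemLp (fun ω => polyVar W p ω • h) 2 P := by
  simpa [Function.comp_def] using (ContinuousLinearMap.toSpanSingleton ℝ h).comp_memLp'
    (memLp_polyVar W hH₁ p (q := 2) (by simp))

/-- The class in `L²(Ω; H)` of the product of a polynomial random variable with an element
of `H`. -/
def polySmulLp (p : MvPolynomial H ℝ) (h : H) : Lp H 2 P :=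
  (memLp_polyVar_smul W p h hH₁).toLp

theorem coeFn_polySmulLp (p : MvPolynomial H ℝ) (h : H) :
    polySmulLp hH₁ W p h =ᵐ[P] fun ω => polyVar W p ω • h :=
  MemLp.coeFn_toLp _

theorem polyLp_sum {ι : Type*} (s : Finset ι) (p : ι → MvPolynomial H ℝ) :
    polyLp hH₁ W (∑ i ∈ s, p i) = ∑ i ∈ s, polyLp hH₁ W (p i) := by
  refine Lp.ext ?_
  filter_upwards [coeFn_polyLp hH₁ W (∑ i ∈ s, p i),
    Lp.coeFn_finsetSum s fun i => polyLp hH₁ W (p i),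
    (s.eventually_all).2 fun i _ => coeFn_polyLp hH₁ W (p i)] with ω h1 h2 h3
  rw [h1, h2, Finset.sum_apply, polyVar_sum]
  exact Finset.sum_congr rfl fun i hi => (h3 i hi).symm

/-- The divergence of a polynomial random variable times an element of `H`. -/
theorem polySmulLp_mem_adjoint (p : MvPolynomial H ℝ) (h : H) :
    (polySmulLp hH₁ W p h, polyLp hH₁ W (p * MvPolynomial.X h - dirDeriv h p)) ∈
      (polyGraph W).adjoint := by
  rw [Submodule.mem_adjoint_iff]
  rintro F U ⟨m, q, k, hF, hU⟩
  rw [sub_eq_zero]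
  have h1 : inner ℝ U (polySmulLp hH₁ W p h) =
      polyExp W hH₁ (p * dirDeriv h (MvPolynomial.rename k q)) := by
    rw [L2.inner_def, polyExp_apply]
    refine integral_congr_ae ?_
    filter_upwards [hU, coeFn_polySmulLp hH₁ W p h] with ω h2 h3
    change U ω = _ at h2
    rw [h2, h3, real_inner_smul_right, sum_inner, polyVar_mul, dirDeriv_rename, polyVar_sum]
    congr 1
    refine Finset.sum_congr rfl fun j _ => ?_
    rw [real_inner_smul_left, polyVar_smul, polyVar_rename, mul_comm]
  have h2 : inner ℝ F (polyLp hH₁ W (p * MvPolynomial.X h - dirDeriv h p)) =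
      polyExp W hH₁ ((p * MvPolynomial.X h - dirDeriv h p) * MvPolynomial.rename k q) := by
    rw [L2.inner_def, polyExp_apply]
    refine integral_congr_ae ?_
    filter_upwards [hF, coeFn_polyLp hH₁ W (p * MvPolynomial.X h - dirDeriv h p)] with ω h3 h4
    change F ω = _ at h3
    rw [h3, h4, polyVar_mul, polyVar_rename]
    rfl
  rw [h1, h2, polyExp_mul_dirDeriv]

/-- `(F, δ D F)` for a polynomial random variable `F`. -/
theorem polyLp_mem_adjointComp {m : ℕ} (k : Fin m → H) (p : MvPolynomial (Fin m) ℝ) :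
    (polyLp hH₁ W (MvPolynomial.rename k p),
      polyLp hH₁ W (MvPolynomial.rename k (numberOp k p))) ∈
        adjointComp (polyGraph W).topologicalClosure := by
  refine ⟨∑ j, polySmulLp hH₁ W (MvPolynomial.rename k (MvPolynomial.pderiv j p)) (k j),
    Submodule.le_topologicalClosure _ ⟨m, p, k, ?_, ?_⟩, ?_⟩
  · filter_upwards [coeFn_polyLp hH₁ W (MvPolynomial.rename k p)] with ω h1
    rw [h1, polyVar_rename]
  · filter_upwards [Lp.coeFn_finsetSum Finset.univ fun j =>
        polySmulLp hH₁ W (MvPolynomial.rename k (MvPolynomial.pderiv j p)) (k j),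
      ae_all_iff.2 fun j => coeFn_polySmulLp hH₁ W
        (MvPolynomial.rename k (MvPolynomial.pderiv j p)) (k j)] with ω h1 h2
    rw [h1, Finset.sum_apply]
    exact Finset.sum_congr rfl fun j _ => by rw [h2, polyVar_rename]
  · rw [adjoint_topologicalClosure, rename_numberOp, polyLp_sum]
    have h1 := (polyGraph W).adjoint.sum_mem (t := Finset.univ) fun j _ => polySmulLp_mem_adjoint hH₁ W
        (MvPolynomial.rename k (MvPolynomial.pderiv j p)) (k j)
    convert h1 using 1
    refine Prod.ext ?_ ?_
    · rw [Prod.fst_sum]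
    · rw [Prod.snd_sum]

theorem polyLp_rename_mem_polySpace {m n : ℕ} (k : Fin m → H) {p : MvPolynomial (Fin m) ℝ}
    (hp : p.totalDegree ≤ n) : polyLp hH₁ W (MvPolynomial.rename k p) ∈ polySpace H₁ n := by
  refine ⟨m, p, fun i => W (k i), hp, ?_⟩
  filter_upwards [coeFn_polyLp hH₁ W (MvPolynomial.rename k p)] with ω h1
  rw [h1, polyVar_rename]

theorem exists_polyLp_rename_of_mem_polySpace {n : ℕ} {F : Lp ℝ 2 P} (hF : F ∈ polySpace H₁ n) :
    ∃ (m : ℕ) (k : Fin m → H) (p : MvPolynomial (Fin m) ℝ), p.totalDegree ≤ n ∧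
      F = polyLp hH₁ W (MvPolynomial.rename k p) := by
  obtain ⟨m, p, ξ, hp, hF⟩ := hF
  refine ⟨m, fun i => W.symm (ξ i), p, hp, Lp.ext ?_⟩
  filter_upwards [hF, coeFn_polyLp hH₁ W (MvPolynomial.rename (fun i => W.symm (ξ i)) p)]
    with ω h1 h2
  rw [h1, h2, polyVar_rename]
  simp

/-- The place where the Gaussian computation meets the abstract spectral argument. -/
theorem isNumberRelation_adjointComp [CompleteSpace H] (hH₁ : IsGaussianHilbertSpace H₁) :
    IsNumberRelation H₁ (adjointComp (polyGraph W).topologicalClosure) where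
  isClosed := isClosed_adjointComp (Submodule.isClosed_topologicalClosure _)
  symmetric _ hx _ hy := adjointComp_symmetric _ hx hy
  zero F hF := by
    obtain ⟨m, k, p, hp, rfl⟩ := exists_polyLp_rename_of_mem_polySpace hH₁ W hF
    have h1 := polyLp_mem_adjointComp hH₁ W k p
    have h0 : polyLp hH₁ W 0 = 0 := by
      simpa using polyLp_sum hH₁ W (∅ : Finset ℕ) fun _ => 0
    rwa [numberOp_of_totalDegree_eq_zero k (Nat.le_zero.1 hp), map_zero, h0] at h1
  succ n F hF := by
    obtain ⟨m, k, p, hp, rfl⟩ := exists_polyLp_rename_of_mem_polySpace hH₁ W hF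
    refine ⟨_, polyLp_mem_adjointComp hH₁ W k p, ?_⟩
    have h1 := polyLp_rename_mem_polySpace hH₁ W k (totalDegree_numberOp_sub_le k hp)
    convert h1 using 1
    refine Lp.ext ?_
    filter_upwards [coeFn_polyLp hH₁ W (MvPolynomial.rename k p),
      coeFn_polyLp hH₁ W (MvPolynomial.rename k (numberOp k p)),
      coeFn_polyLp hH₁ W (MvPolynomial.rename k (numberOp k p - ((n + 1 : ℕ) : ℝ) • p)),
      Lp.coeFn_sub (polyLp hH₁ W (MvPolynomial.rename k (numberOp k p)))
        (((n + 1 : ℕ) : ℝ) • polyLp hH₁ W (MvPolynomial.rename k p)),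
      Lp.coeFn_smul ((n + 1 : ℕ) : ℝ) (polyLp hH₁ W (MvPolynomial.rename k p))]
      with ω h2 h3 h4 h5 h6
    rw [h5, Pi.sub_apply, h6, Pi.smul_apply, h2, h3, h4, map_sub, map_smul, polyVar_sub,
      polyVar_smul, smul_eq_mul]

include hH₁

/-- The derivative on polynomials is closable. -/
theorem snd_eq_zero_of_mem_closure_polyGraph [TopologicalSpace.SeparableSpace H]
    (hσ : mΩ = sigmaField H₁) (x : Lp ℝ 2 P × Lp H 2 P)
    (hx : x ∈ (polyGraph W).topologicalClosure) (hx0 : x.1 = 0) : x.2 = 0 := by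
  refine Lp.ext (Filter.EventuallyEq.trans ?_ (Lp.coeFn_zero H 2 P).symm)
  -- Separability of `H` lets each direction `h` be tested separately.
  refine ae_eq_zero_of_forall_inner (𝕜 := ℝ) fun h => ?_
  have hm : MemLp (fun ω => inner ℝ h (x.2 ω)) 2 P := (Lp.memLp x.2).const_inner h
  have h0 : hm.toLp = 0 := by
    refine eq_zero_of_forall_inner_polySpace hH₁ hσ fun n F hF => ?_
    obtain ⟨m, k, p, -, rfl⟩ := exists_polyLp_rename_of_mem_polySpace hH₁ W hF
    have h1 := polySmulLp_mem_adjoint hH₁ W (MvPolynomial.rename k p) h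
    rw [← adjoint_topologicalClosure] at h1
    -- Pairing `x.2` with a polynomial times `h` moves the derivative onto the divergence, leaving
    -- an inner product with `x.1 = 0`.
    have h2 := inner_eq_of_mem_adjoint hx h1
    rw [hx0, inner_zero_left, L2.inner_def] at h2
    rw [L2.inner_def, ← h2]
    refine integral_congr_ae ?_
    filter_upwards [hm.coeFn_toLp, coeFn_polyLp hH₁ W (MvPolynomial.rename k p),
      coeFn_polySmulLp hH₁ W (MvPolynomial.rename k p) h] with ω h3 h4 h5
    rw [h3, h4, h5, real_inner_smul_right, real_inner_comm h]
    exact mul_comm _ _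
  have h1 := hm.coeFn_toLp
  rw [h0] at h1
  exact h1.symm.trans (Lp.coeFn_zero ℝ 2 P)

theorem graph_D [TopologicalSpace.SeparableSpace H] (hσ : mΩ = sigmaField H₁) :
    (D W).graph = (polyGraph W).topologicalClosure :=
  Submodule.toLinearPMap_graph_eq _ (snd_eq_zero_of_mem_closure_polyGraph hH₁ W hσ)

theorem dense_domain_D (hσ : mΩ = sigmaField H₁) : Dense ((D W).domain : Set (Lp ℝ 2 P)) := by
  rw [Submodule.dense_iff_topologicalClosure_eq_top, Submodule.topologicalClosure_eq_top_iff,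
    Submodule.eq_bot_iff]
  refine fun x hx => eq_zero_of_forall_inner_polySpace hH₁ hσ fun n F hF => ?_
  obtain ⟨m, k, p, -, rfl⟩ := exists_polyLp_rename_of_mem_polySpace hH₁ W hF
  obtain ⟨u, hu, -⟩ := polyLp_mem_adjointComp hH₁ W k p
  exact (Submodule.mem_orthogonal _ _).1 hx _ ⟨_, hu, rfl⟩

/-- Density of the domain of `D` is what makes the operator adjoint agree with the adjoint of the
graph. -/
theorem graph_δ [CompleteSpace H] [TopologicalSpace.SeparableSpace H]
    (hσ : mΩ = sigmaField H₁) :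
    (δ W).graph = (polyGraph W).topologicalClosure.adjoint := by
  rw [← graph_D hH₁ W hσ]
  exact LinearPMap.adjoint_graph_eq_graph_adjoint (dense_domain_D hH₁ W hσ)

theorem mem_adjointComp_iff [CompleteSpace H] [TopologicalSpace.SeparableSpace H]
    (hσ : mΩ = sigmaField H₁) {F G : Lp ℝ 2 P} :
    (F, G) ∈ adjointComp (polyGraph W).topologicalClosure ↔
      ∃ (hD : F ∈ (D W).domain) (hδ : D W ⟨F, hD⟩ ∈ (δ W).domain),
        δ W ⟨D W ⟨F, hD⟩, hδ⟩ = G := by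
  constructor
  · rintro ⟨u, hu, hu'⟩
    rw [← graph_D hH₁ W hσ] at hu
    rw [← graph_δ hH₁ W hσ] at hu'
    obtain ⟨⟨y, hy⟩, rfl, rfl⟩ := (LinearPMap.mem_graph_iff _).1 hu
    obtain ⟨⟨z, hz⟩, h1, h2⟩ := (LinearPMap.mem_graph_iff _).1 hu'
    simp only at h1 h2
    subst h1
    exact ⟨hy, hz, h2⟩
  · rintro ⟨hD, hδ, rfl⟩
    refine ⟨D W ⟨F, hD⟩, ?_, ?_⟩
    · rw [← graph_D hH₁ W hσ]
      exact (D W).mem_graph ⟨F, hD⟩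
    · rw [← graph_δ hH₁ W hσ]
      exact (δ W).mem_graph ⟨_, hδ⟩

end Divergence

end Malliavin

end

theorem mainTheorem8 {Ω : Type*} [mΩ : MeasurableSpace Ω] (P : Measure Ω) [IsProbabilityMeasure P]
    (H₁ : Submodule ℝ (Lp ℝ 2 P)) (hH₁ : Malliavin.IsGaussianHilbertSpace H₁)
    (hσ : mΩ = Malliavin.sigmaField H₁)
    {H : Type*} [NormedAddCommGroup H] [InnerProductSpace ℝ H] [CompleteSpace H]
    [TopologicalSpace.SeparableSpace H] (W : H ≃ₗᵢ[ℝ] H₁) (F : Lp ℝ 2 P) :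
    (F ∈ (Malliavin.L H₁).domain ↔
      ∃ hD : F ∈ (Malliavin.D W).domain, Malliavin.D W ⟨F, hD⟩ ∈ (Malliavin.δ W).domain) ∧
    ∀ (hL : F ∈ (Malliavin.L H₁).domain) (hD : F ∈ (Malliavin.D W).domain)
      (hδ : Malliavin.D W ⟨F, hD⟩ ∈ (Malliavin.δ W).domain),
      Malliavin.δ W ⟨Malliavin.D W ⟨F, hD⟩, hδ⟩ = - Malliavin.L H₁ ⟨F, hL⟩ := by
  -- Membership of `(F, G)` in `D* D` is read in two ways: as `δ(DF) = G` and as `G = -LF`, each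
  -- with its domain conditions.
  have hiff : ∀ G : Lp ℝ 2 P, _ ↔ _ := fun G =>
    (Malliavin.mem_adjointComp_iff hH₁ W hσ (F := F) (G := G)).symm.trans
      ((Malliavin.isNumberRelation_adjointComp W hH₁).mem_iff
        (fun _ hx => Malliavin.eq_zero_of_forall_inner_polySpace hH₁ hσ hx))
  refine ⟨⟨fun hL => ?_, ?_⟩, fun hL hD hδ => ?_⟩
  · obtain ⟨hD, hδ, -⟩ := (hiff _).2 ⟨hL, rfl⟩
    exact ⟨hD, hδ⟩
  · rintro ⟨hD, hδ⟩
    exact ((hiff _).1 ⟨hD, hδ, rfl⟩).1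
  · exact ((hiff _).1 ⟨hD, hδ, rfl⟩).2
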